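/- Let $\varepsilon\in(-1,1)$, let $\mathbb T=\mathbb R^2/\mathbb Z^2$ with coordinates $(x,y)$, and let $F_\varepsilon$ be the Katok–Ziller metric on $\mathbb T$ associated with the standard flat metric $F_0$ and the Killing field $V=\partial/\partial x$. That is, $F_\varepsilon=H_\varepsilon\circ\mathcal L_\varepsilon^{-1}$, where $H_\varepsilon(p)=H_0(p)+\varepsilon\,p(V)$ on $T^*\mathbb T$, $H_0=F_0\circ\mathcal L_0^{-1}$ is the dual norm of $F_0$ ($\mathcal L_0\colon T\mathbb T\to T^*\mathbb T$ being the Legendre transform of $\tfrac12F_0^2$), and $\mathcal L_\varepsilon\colon T^*\mathbb T\to T\mathbb T$ is the Legendre transform of $\tfrac12H_\varepsilon^2$. For a Finsler metric $F$ on $\mathbb T$, let $H\mathbb T=(T\mathbb T\smallsetminus 0)/\mathbb R^+$ with projection $\pi\colon H\mathbb T\to\mathbb T$, let $A=\frac{\partial F}{\partial v^i}dx^i$ be the Hilbert form on $H\mathbb T$, and let $X$ be its Reeb field ($A(X)=1$, $i_XdA=0$). Let $\Omega^F$ be the volume form on $\mathbb T$ and $\alpha^F$ a $1$-form on $H\mathbb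 T$, nowhere zero on $\ker d\pi$, such that $\alpha^F\wedge\pi^*\Omega^F=A\wedge dA$ and $\int_{H_q\mathbb T}\alpha^F=2\pi$ for all $q\in\mathbb T$; the fibres are oriented counterclockwise. The Finsler–Laplace operator is $$\Delta^Ff(q)=\frac1\pi\int_{H_q\mathbb T}L_X^2(\pi^*f)\,\alpha^F .$$ Then $F_\varepsilon$ is a smooth Finsler metric, given by $$F_\varepsilon(x,y;\xi_x,\xi_y)=\frac1{1-\varepsilon^2}\Bigl(\sqrt{\xi_x^2+(1-\varepsilon^2)\xi_y^2}-\varepsilon\xi_x\Bigr),$$ and, on $C^2$ functions $f\colon\mathbb T\to\mathbb C$ (in particular on smooth ones), $$\Delta^{F_\varepsilon}=\frac{2(1-\varepsilon^2)}{1+\sqrt{1-\varepsilon^2}}\left(\sqrt{1-\varepsilon^2}\,\frac{\partial^2}{\partial x^2}+\frac{\partial^2}{\partial y^2}\right).$$ The spectrum of $-\Delta^{F_\varepsilon}$, i.e. the set of $\lambda\in\mathbb C$ for which $\Delta^{F_\varepsilon}u+\lambda u=0$ has a nonzero solution $u\in C^\infty(\mathbb T,\mathbb C)$, is $$\left\{4\pi^2\,\frac{2(1-\varepsilon^2)}{1+\sqrt{1-\varepsilon^2}}\left(\sqrt{1-\varepsilon^2}\,p^2+q^2\right)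 : (p,q)\in\mathbb Z^2\right\}.$$ -/

import Mathlib

open scoped ContDiff Real

noncomputable section

namespace FinslerTorus

/-! ### The torus, its tangent bundle and its homogenized bundle -/

/-- The Euclidean plane `ℝ²`. -/
abbrev Plane : Type := EuclideanSpace ℝ (Fin 2)

/-- The torus `𝕋 = ℝ² / ℤ²`. Its tangent bundle is `Torus × Plane`, through the global frame
`∂/∂x, ∂/∂y`. -/
abbrev Torus : Type := UnitAddTorus (Fin 2)

/-- The universal covering `ℝ² → 𝕋`. For each `q`, the map `u ↦ q + toTorus u` is (near `0`) a chart
of `𝕋` centred at `q`; all these charts have the same coordinate frame `∂/∂x, ∂/∂y`. -/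
def toTorus (x : Plane) : Torus := fun i => (x i : UnitAddCircle)

/-- A map on the torus is `C^k` if its lift to `ℝ²` is. -/
def TorusContDiff {W : Type*} [NormedAddCommGroup W] [NormedSpace ℝ W] (k : WithTop ℕ∞)
    (f : Torus → W) : Prop :=
  ContDiff ℝ k (fun x : Plane => f (toTorus x))

/-- The partial derivative `∂f/∂x` (`i = 0`) or `∂f/∂y` (`i = 1`) of a function on the torus. -/
def torusPartial (i : Fin 2) (f : Torus → ℂ) (q : Torus) : ℂ :=
  deriv (fun s : ℝ => f (q + toTorus (EuclideanSpace.single i s))) 0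

/-- The homogenized bundle `H𝕋 = (T𝕋 ∖ {zero section}) / ℝ⁺`: the pair `(q, θ)` stands for the class
of the tangent vectors `(q, r (cos θ, sin θ))`, `r > 0`. The projection `π : H𝕋 → 𝕋` is `Prod.fst`,
and the fibre `H_q𝕋` is the circle `{q} × Real.Angle`. -/
abbrev HTorus : Type := Torus × Real.Angle

/-- The model space of `H𝕋`, with coordinates `((x, y), t)`. -/
abbrev HModel : Type := Plane × ℝ

/-- The universal covering `ℝ² × ℝ → H𝕋`. For each `h`, the map `u ↦ h + toH u` is (near `0`) a chart
of `H𝕋` centred at `h`; all these charts have the same coordinate frame `∂/∂x, ∂/∂y, ∂/∂t`. -/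
def toH (z : HModel) : HTorus := (toTorus z.1, (z.2 : Real.Angle))

/-- The vertical coordinate vector `∂/∂t`; it spans `VH𝕋 = ker dπ`. -/
def vert : HModel := (0, 1)

/-- The differential of `π : H𝕋 → 𝕋`. -/
def dπ : HModel →L[ℝ] Plane := ContinuousLinearMap.fst ℝ Plane ℝ

/-- The representative `(cos θ, sin θ)` of a direction `θ`. -/
def dir (θ : Real.Angle) : Plane := !₂[θ.cos, θ.sin]

/-- A differential `k`-form on `H𝕋`, in the frame `∂/∂x, ∂/∂y, ∂/∂t`. -/
abbrev HForm (k : ℕ) : Type := HTorus → HModel [⋀^Fin k]→L[ℝ] ℝ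

/-- The exterior derivative of a form on `H𝕋`, computed at `h` in the chart centred at `h`. -/
def HForm.d {k : ℕ} (η : HForm k) : HForm (k + 1) := fun h =>
  extDeriv (fun u : HModel => η (h + toH u)) 0

/-- The value at a triple of vectors of the wedge product of a `1`-form and a `2`-form:
`(η ∧ β)(v₀, v₁, v₂) = η(v₀) β(v₁, v₂) - η(v₁) β(v₀, v₂) + η(v₂) β(v₀, v₁)`. -/
def wedge (η : HModel [⋀^Fin 1]→L[ℝ] ℝ) (β : HModel [⋀^Fin 2]→L[ℝ] ℝ) (v : Fin 3 → HModel) : ℝ :=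
  ∑ i : Fin 3, (-1 : ℝ) ^ (i : ℕ) * (η ![v i] * β (i.removeNth v))

/-- The Lie derivative `L_X φ = dφ(X)` of a function on `H𝕋` along a vector field. -/
def lieDeriv (X : HTorus → HModel) (φ : HTorus → ℂ) : HTorus → ℂ := fun h =>
  fderiv ℝ (fun u : HModel => φ (h + toH u)) 0 (X h)

/-! ### Finsler metrics and the Finsler–Laplace operator -/

/-- Smooth Finsler metrics on the torus (not necessarily reversible). -/
structure IsFinslerMetric (F : Torus → Plane → ℝ) : Prop where
  continuous : Continuous (fun p : Torus × Plane => F p.1 p.2)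
  smooth : ContDiffOn ℝ ∞ (fun p : Plane × Plane => F (toTorus p.1) p.2) {p | p.2 ≠ 0}
  homogeneous : ∀ q v, ∀ c : ℝ, 0 < c → F q (c • v) = c * F q v
  nonneg : ∀ q v, 0 ≤ F q v
  eq_zero_iff : ∀ q v, F q v = 0 ↔ v = 0
  stronglyConvex : ∀ q v, v ≠ 0 → ∀ w, w ≠ 0 →
    0 < iteratedFDeriv ℝ 2 (fun u => F q u ^ 2) v ![w, w]

/-- The Hilbert form `A` on `H𝕋`, i.e. `r^* A = d_v F = (∂F/∂v^i) dx^i` where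
`r : T𝕋 ∖ {0} → H𝕋`. As `d_v F` is homogeneous of degree `0`, it may be evaluated at the
representative `(cos θ, sin θ)`. -/
def hilbertForm (F : Torus → Plane → ℝ) : HForm 1 := fun h =>
  ContinuousAlternatingMap.ofSubsingleton ℝ HModel ℝ (0 : Fin 1)
    ((fderiv ℝ (F h.1) (dir h.2)).comp dπ)

/-- `X` is the Reeb field of the Hilbert form `A`: `A(X) = 1` and `i_X dA = 0`. -/
def IsReebField (F : Torus → Plane → ℝ) (X : HTorus → HModel) : Prop :=
  ∀ h, hilbertForm F h ![X h] = 1 ∧ ∀ w, (hilbertForm F).d h ![X h, w] = 0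

/-- The Reeb field of the Hilbert form of `F` (the generator of the geodesic flow). -/
def reebField (F : Torus → Plane → ℝ) : HTorus → HModel :=
  Classical.epsilon (IsReebField F)

/-- `α` is an angle form on `H𝕋` and `Ω` a volume form on `𝕋` such that `α ∧ π^*Ω = A ∧ dA` and
every fibre has total angle `vol(𝕊¹) = 2π`. Fibres are oriented counterclockwise. -/
structure IsAngleVolumePair (F : Torus → Plane → ℝ) (α : HForm 1)
    (Ω : Torus → Plane [⋀^Fin 2]→L[ℝ] ℝ) : Prop where
  smooth_angle : ContDiff ℝ ∞ (fun z : HModel => α (toH z))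
  angle_ne_zero : ∀ h, α h ![vert] ≠ 0
  smooth_volume : TorusContDiff ∞ Ω
  volume_ne_zero : ∀ q, Ω q ≠ 0
  wedge_eq : ∀ h v, wedge (α h) ((Ω h.1).compContinuousLinearMap dπ) v
    = wedge (hilbertForm F h) ((hilbertForm F).d h) v
  total_angle : ∀ q, ∫ t in (0 : ℝ)..(2 * π), α (q, (t : Real.Angle)) ![vert] = 2 * π

/-- The angle form `α^F`; its restriction to the fibres does not depend on the choice made. -/
def angleForm (F : Torus → Plane → ℝ) : HForm 1 :=
  Classical.epsilon fun α => ∃ Ω, IsAngleVolumePair F α Ω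

/-- The Finsler–Laplace operator of a Finsler metric on the torus (dimension `n = 2`):
`Δ^F f (q) = (n / vol(𝕊^(n-1))) ∫_{H_q𝕋} L_X²(π^* f) α^F`. -/
def finslerLaplacian (F : Torus → Plane → ℝ) (f : Torus → ℂ) (q : Torus) : ℂ :=
  (2 / (2 * π) : ℝ) • ∫ t in (0 : ℝ)..(2 * π),
    (angleForm F (q, (t : Real.Angle)) ![vert]) •
      lieDeriv (reebField F) (lieDeriv (reebField F) (fun h => f h.1)) (q, (t : Real.Angle))

/-- The spectrum of `-Δ^F`: the numbers `λ` for which `Δ^F u + λ u = 0` has a smooth nonzero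
solution `u` on the (closed) torus. -/
def laplaceSpectrum (F : Torus → Plane → ℝ) : Set ℂ :=
  {l | ∃ u : Torus → ℂ, TorusContDiff ∞ u ∧ u ≠ 0 ∧ ∀ q, finslerLaplacian F u q + l * u q = 0}

/-! ### Katok–Ziller metrics -/

/-- The Legendre transform `d_v (G² / 2)` associated with `G² / 2`, on a single fibre. -/
def legendre {W : Type*} [NormedAddCommGroup W] [NormedSpace ℝ W] (G : W → ℝ) :
    W → StrongDual ℝ W :=
  fderiv ℝ (fun w => G w ^ 2 / 2)

/-- The Hamiltonian `H_ε = H₀ + ε H₁` on `T^*𝕋`, with `H₀ = F₀ ∘ ℒ₀⁻¹`, where `ℒ₀ : T𝕋 → T^*𝕋` is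
the Legendre transform of `F₀² / 2`, and `H₁(p) = p(V)`. -/
def katokZillerHamiltonian (F₀ : Torus → Plane → ℝ) (V : Torus → Plane) (ε : ℝ) (q : Torus)
    (p : StrongDual ℝ Plane) : ℝ :=
  F₀ q (Function.invFun (legendre (F₀ q)) p) + ε * p (V q)

/-- The Katok–Ziller metric `F_ε = H_ε ∘ ℒ_ε⁻¹`, where `ℒ_ε : T^*𝕋 → T^{**}𝕋 = T𝕋` is the Legendre
transform of `H_ε² / 2`. -/
def katokZiller (F₀ : Torus → Plane → ℝ) (V : Torus → Plane) (ε : ℝ) (q : Torus) (v : Plane) : ℝ :=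
  katokZillerHamiltonian F₀ V ε q
    (Function.invFun (legendre (katokZillerHamiltonian F₀ V ε q))
      (NormedSpace.inclusionInDoubleDual ℝ Plane v))

/-- The Katok–Ziller metric on the torus associated with the standard flat metric and the Killing
field `V = ∂/∂x`. -/
def torusKatokZiller (ε : ℝ) : Torus → Plane → ℝ :=
  katokZiller (fun _ v => ‖v‖) (fun _ => EuclideanSpace.single 0 1) ε

end FinslerTorus

end

open FinslerTorus

noncomputable section

namespace FinslerTorus
-- Everything reduces to one norm on a fixed plane. The Hamiltonian is `|p| + ε p₀`, so the Legendre
-- transform sends `p` to `v = H (u + ε e₀)` with `u = p/|p|`. The unit circle of `F_ε` is thus the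
-- Euclidean one translated by `ε e₀`, and solving `|v - ε F e₀| = F` for `F` gives the Randers
-- formula.
--
-- Write `a = 1 - ε²`, `R` for the Euclidean part of the norm on the unit circle, and `P = (P₀, P₁)`
-- for the gradient of `F`. By translation invariance `A = P₀ dx + P₁ dy` has coefficients depending
-- only on the angle `t`. Hence the Reeb field is the horizontal vector `dir / F(dir)` (geodesics
-- are straight lines), and `A ∧ dA` is `-(P₀P₁' - P₁P₀') dt ∧ dx ∧ dy`. The normalisation of the
-- fibres then determines the angle form along them (`IsAngleVolumePair.apply_vert`): its density is
-- `√a (R - ε cos t) / R³`.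
--
-- Since the direction is constant along `X`, `L_X² f` is the Hessian of `f` on the unit vector, and
-- the Laplacian has as coefficients the second moments of the unit vector. As `(R - ε cos t)(R + ε
-- cos t) = a`, these are integrals of quadratic monomials in `cos`, `sin` against `(1 + ε cos t /
-- R) / R²`; the term in `ε cos t / R` cancels under a half-turn, leaving elementary integrals.
--
-- The operator has constant coefficients, so Fourier coefficients diagonalise it: every eigenvalue
-- is read off a nonzero coefficient of an eigenfunction, and every exponential is an eigenfunction.
theorem one_sub_sq_pos {ε : ℝ} (hε : |ε| < 1) : 0 < 1 - ε ^ 2 := by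
  have := (sq_lt_one_iff_abs_lt_one ε).2 hε
  linarith

/-! ### Legendre duality and the closed form of the metric -/

/-- The closed form of the Katok–Ziller metric, a translation invariant Randers norm. -/
def randersNorm (ε : ℝ) (v : Plane) : ℝ :=
  1 / (1 - ε ^ 2) * (√(v 0 ^ 2 + (1 - ε ^ 2) * v 1 ^ 2) - ε * v 0)

/-- The `i`-th coordinate vector field. -/
abbrev frame (i : Fin 2) : Plane := EuclideanSpace.single i 1

theorem plane_ext {v w : Plane} (h0 : v 0 = w 0) (h1 : v 1 = w 1) : v = w := by
  ext i
  fin_cases i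
  · exact h0
  · exact h1

theorem plane_eq_frame (v : Plane) : v = v 0 • frame 0 + v 1 • frame 1 := by
  apply plane_ext <;> simp

theorem dual_norm_eq (p : StrongDual ℝ Plane) :
    ‖p‖ = √(p (frame 0) ^ 2 + p (frame 1) ^ 2) := by
  obtain ⟨u, rfl⟩ := (InnerProductSpace.toDual ℝ Plane).surjective p
  rw [LinearIsometryEquiv.norm_map, EuclideanSpace.norm_eq]
  simp [EuclideanSpace.inner_single_right]

theorem legendre_norm (u : Plane) : legendre (fun v : Plane => ‖v‖) u = innerSL ℝ u := by
  have h := ((hasStrictFDerivAt_norm_sq u).hasFDerivAt).mul_const (1 / 2 : ℝ)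
  have h' := h.congr_of_eventuallyEq (f₁ := fun w : Plane => ‖w‖ ^ 2 / 2)
    (Filter.Eventually.of_forall fun w => by ring)
  rw [legendre, h'.fderiv]
  ext w
  simp

/-- The Euclidean Legendre transform is the Riesz isometry; its surjectivity makes `Function.invFun`
a genuine right inverse. -/
theorem norm_invFun_legendre_norm (p : StrongDual ℝ Plane) :
    ‖Function.invFun (legendre (fun v : Plane => ‖v‖)) p‖ = ‖p‖ := by
  have hex : ∃ u, legendre (fun v : Plane => ‖v‖) u = p := by
    obtain ⟨u, rfl⟩ := (InnerProductSpace.toDual ℝ Plane).surjective p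
    refine ⟨u, ?_⟩
    rw [legendre_norm]
    ext w
    simp
  have h := Function.invFun_eq hex
  conv_rhs => rw [← h, legendre_norm, innerSL_apply_norm]

/-- The Hamiltonian of the Katok–Ziller metric in the coordinates `(p₀, p₁)` of a covector. -/
def torusHamiltonian (ε : ℝ) (p : StrongDual ℝ Plane) : ℝ :=
  √(p (frame 0) ^ 2 + p (frame 1) ^ 2) + ε * p (frame 0)

theorem katokZillerHamiltonian_eq (ε : ℝ) (q : Torus) :
    katokZillerHamiltonian (fun _ v => ‖v‖) (fun _ => EuclideanSpace.single 0 1) ε q =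
      torusHamiltonian ε := by
  ext p
  simp only [katokZillerHamiltonian, torusHamiltonian, norm_invFun_legendre_norm, dual_norm_eq]

theorem legendre_torusHamiltonian (ε : ℝ) {p : StrongDual ℝ Plane}
    (hp : 0 < p (frame 0) ^ 2 + p (frame 1) ^ 2) :
    legendre (torusHamiltonian ε) p = NormedSpace.inclusionInDoubleDual ℝ Plane
      (torusHamiltonian ε p •
        !₂[p (frame 0) / √(p (frame 0) ^ 2 + p (frame 1) ^ 2) + ε,
          p (frame 1) / √(p (frame 0) ^ 2 + p (frame 1) ^ 2)]) := by
  have h0 : HasFDerivAt (fun p : StrongDual ℝ Plane => p (frame 0))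
    (NormedSpace.inclusionInDoubleDual ℝ Plane (frame 0)) p :=
    (NormedSpace.inclusionInDoubleDual ℝ Plane (frame 0)).hasFDerivAt
  have h1 : HasFDerivAt (fun p : StrongDual ℝ Plane => p (frame 1))
    (NormedSpace.inclusionInDoubleDual ℝ Plane (frame 1)) p :=
    (NormedSpace.inclusionInDoubleDual ℝ Plane (frame 1)).hasFDerivAt
  have h := (((((h0.pow 2).add (h1.pow 2)).sqrt hp.ne').add (h0.const_mul ε)).pow 2).mul_const
    (1 / 2 : ℝ)
  have h' := h.congr_of_eventuallyEq (f₁ := fun p => torusHamiltonian ε p ^ 2 / 2)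
    (Filter.Eventually.of_forall fun x => by
      simp only [torusHamiltonian, Pi.add_apply]; ring)
  rw [legendre, h'.fderiv]
  ext w
  have hw : ∀ x : StrongDual ℝ Plane, ∀ v : Plane, x v = v 0 * x (frame 0) + v 1 * x (frame 1) := by
    intro x v
    conv_lhs => rw [plane_eq_frame v]
    simp
  have hs : 0 < √(p (frame 0) ^ 2 + p (frame 1) ^ 2) := Real.sqrt_pos.2 hp
  simp [torusHamiltonian, NormedSpace.dual_def]
  rw [hw w (!₂[_, _])]
  simp
  field_simp
  ring

theorem torusHamiltonian_nonneg {ε : ℝ} (hε : |ε| < 1) (p : StrongDual ℝ Plane) :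
    0 ≤ torusHamiltonian ε p := by
  have h1 : |p (frame 0)| ≤ √(p (frame 0) ^ 2 + p (frame 1) ^ 2) :=
    Real.abs_le_sqrt (by nlinarith [sq_nonneg (p (frame 1))])
  have h2 : |ε * p (frame 0)| ≤ |p (frame 0)| := by
    rw [abs_mul]
    nlinarith [abs_nonneg (p (frame 0))]
  have h3 := neg_abs_le (ε * p (frame 0))
  rw [torusHamiltonian]
  linarith

/-- The square root is not differentiable at the origin, so the general formula does not apply
there; but `H² / 2` has its minimum at `0`. -/
theorem legendre_torusHamiltonian_zero {ε : ℝ} : legendre (torusHamiltonian ε) 0 = 0 := by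
  apply IsLocalMin.fderiv_eq_zero
  refine Filter.Eventually.of_forall fun p => ?_
  have : torusHamiltonian ε 0 = 0 := by simp [torusHamiltonian]
  simp only [this, ne_eq, OfNat.ofNat_ne_zero, not_false_eq_true, zero_pow, zero_div]
  positivity

theorem eq_zero_of_coord_sq {p : StrongDual ℝ Plane}
    (hp : ¬ 0 < p (frame 0) ^ 2 + p (frame 1) ^ 2) : p = 0 := by
  rw [← norm_eq_zero, dual_norm_eq, Real.sqrt_eq_zero']
  exact not_lt.1 hp

/-- Any preimage `p` of `v` gives the same value, so injectivity of the Legendre transform is not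
needed to evaluate `Function.invFun`. -/
theorem torusHamiltonian_eq_randersNorm {ε : ℝ} (hε : |ε| < 1) {p : StrongDual ℝ Plane} {v : Plane}
    (h : legendre (torusHamiltonian ε) p = NormedSpace.inclusionInDoubleDual ℝ Plane v) :
    torusHamiltonian ε p = randersNorm ε v := by
  have hinj : Function.Injective (NormedSpace.inclusionInDoubleDual ℝ Plane) :=
    (NormedSpace.inclusionInDoubleDualLi ℝ (E := Plane)).injective
  have ha := one_sub_sq_pos hε
  by_cases hp : 0 < p (frame 0) ^ 2 + p (frame 1) ^ 2
  · rw [legendre_torusHamiltonian ε hp] at h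
    have hv := hinj h
    have hH := torusHamiltonian_nonneg hε p
    set H := torusHamiltonian ε p with hHdef
    set r := √(p (frame 0) ^ 2 + p (frame 1) ^ 2) with hr
    have hr0 : 0 < r := Real.sqrt_pos.2 hp
    have hr2 : r ^ 2 = p (frame 0) ^ 2 + p (frame 1) ^ 2 := Real.sq_sqrt hp.le
    have hHr : H = r + ε * p (frame 0) := rfl
    -- With `v = H (u + ε e₀)` and `|u| = 1`, the radicand is a perfect square: `(u₀ + ε)² + (1 -
    -- ε²) u₁² = (1 + ε u₀)²`.
    have key : v 0 ^ 2 + (1 - ε ^ 2) * v 1 ^ 2 = (H * (1 + ε * (p (frame 0) / r))) ^ 2 := by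
      rw [← hv]
      simp
      field_simp
      have : p (frame 1) ^ 2 = r ^ 2 - p (frame 0) ^ 2 := by rw [hr2]; ring
      rw [this]
      ring
    have hnn : 0 ≤ H * (1 + ε * (p (frame 0) / r)) := by
      have : 1 + ε * (p (frame 0) / r) = H / r := by rw [hHr]; field_simp
      rw [this]
      positivity
    rw [randersNorm, key, Real.sqrt_sq hnn, ← hv]
    simp
    field_simp
    ring
  · have hp0 := eq_zero_of_coord_sq hp
    subst hp0
    rw [legendre_torusHamiltonian_zero, ← map_zero (NormedSpace.inclusionInDoubleDual ℝ Plane)] at h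
    rw [← hinj h]
    simp [torusHamiltonian, randersNorm]

theorem sq_add_mul_sq_pos {a : ℝ} (ha : 0 < a) {v : Plane} (hv : v ≠ 0) :
    0 < v 0 ^ 2 + a * v 1 ^ 2 := by
  by_contra hn
  have h0 : v 0 ^ 2 = 0 := by nlinarith [sq_nonneg (v 0), mul_nonneg ha.le (sq_nonneg (v 1))]
  have h1 : a * v 1 ^ 2 = 0 := by nlinarith [sq_nonneg (v 0), mul_nonneg ha.le (sq_nonneg (v 1))]
  apply hv
  apply plane_ext
  · simpa using h0
  · simpa [ha.ne'] using h1

theorem randersNorm_pos {ε : ℝ} (hε : |ε| < 1) {v : Plane} (hv : v ≠ 0) : 0 < randersNorm ε v := by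
  have ha := one_sub_sq_pos hε
  have hD := sq_add_mul_sq_pos ha hv
  have h : ε * v 0 < √(v 0 ^ 2 + (1 - ε ^ 2) * v 1 ^ 2) := by
    apply Real.lt_sqrt_of_sq_lt
    by_cases h0 : v 0 = 0
    · simpa [h0] using hD
    · have : 0 < v 0 ^ 2 := by positivity
      nlinarith [mul_nonneg ha.le (sq_nonneg (v 1))]
  rw [randersNorm]
  have : 0 < √(v 0 ^ 2 + (1 - ε ^ 2) * v 1 ^ 2) - ε * v 0 := by linarith
  positivity

theorem exists_legendre_torusHamiltonian_eq {ε : ℝ} (hε : |ε| < 1) (v : Plane) :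
    ∃ p, legendre (torusHamiltonian ε) p = NormedSpace.inclusionInDoubleDual ℝ Plane v := by
  by_cases hv : v = 0
  · exact ⟨0, by rw [hv, legendre_torusHamiltonian_zero, map_zero]⟩
  have ha := one_sub_sq_pos hε
  have hF := randersNorm_pos hε hv
  set F := randersNorm ε v with hFdef
  obtain ⟨D, hD⟩ : ∃ D, D = √(v 0 ^ 2 + (1 - ε ^ 2) * v 1 ^ 2) := ⟨_, rfl⟩
  have hD2 : D ^ 2 = v 0 ^ 2 + (1 - ε ^ 2) * v 1 ^ 2 := by
    rw [hD, Real.sq_sqrt (sq_add_mul_sq_pos ha hv).le]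
  have hFD : (1 - ε ^ 2) * F = D - ε * v 0 := by
    rw [hFdef, randersNorm, ← hD]
    field_simp
  -- The quadratic equation whose positive root is the Randers norm: `v / F - ε e₀` lies on the unit
  -- circle, and gives the direction of the required covector.
  have hrel : (v 0 - ε * F) ^ 2 + v 1 ^ 2 = F ^ 2 := by
    have : (1 - ε ^ 2) * ((v 0 - ε * F) ^ 2 + v 1 ^ 2 - F ^ 2) = 0 := by
      have hDF : D = (1 - ε ^ 2) * F + ε * v 0 := by linarith
      rw [hDF] at hD2
      linear_combination (-1 : ℝ) * hD2
    have := (mul_eq_zero.1 this).resolve_left ha.ne'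
    linarith
  set u0 := v 0 / F - ε with hu0
  set u1 := v 1 / F with hu1
  have hunit : u0 ^ 2 + u1 ^ 2 = 1 := by
    rw [hu0, hu1]
    field_simp
    linarith
  have hpos : 0 < 1 + ε * u0 := by
    have h1 : |u0| ≤ 1 := by
      apply abs_le_one_iff_mul_self_le_one.2
      nlinarith [sq_nonneg u1]
    have h2 : |ε * u0| < 1 := by
      rw [abs_mul]
      nlinarith [abs_nonneg ε, abs_nonneg u0]
    have := neg_abs_le (ε * u0)
    linarith
  -- The length is forced by `H(r u) = r (1 + ε u₀) = F`.
  set r := F / (1 + ε * u0) with hr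
  have hr0 : 0 < r := by positivity
  set p : StrongDual ℝ Plane := r • innerSL ℝ (!₂[u0, u1] : Plane) with hp
  have hp0 : p (frame 0) = r * u0 := by simp [hp, EuclideanSpace.inner_single_right]
  have hp1 : p (frame 1) = r * u1 := by simp [hp, EuclideanSpace.inner_single_right]
  have hsq : p (frame 0) ^ 2 + p (frame 1) ^ 2 = r ^ 2 := by
    rw [hp0, hp1]
    linear_combination r ^ 2 * hunit
  refine ⟨p, ?_⟩
  rw [legendre_torusHamiltonian ε (by rw [hsq]; positivity), torusHamiltonian, hsq,
    Real.sqrt_sq hr0.le, hp0, hp1]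
  congr 1
  have hH : r + ε * (r * u0) = F := by
    rw [hr]; field_simp
  rw [hH]
  apply plane_ext
  · simp
    rw [hu0]
    field_simp
    ring
  · simp
    rw [hu1]
    field_simp

theorem torusKatokZiller_eq {ε : ℝ} (hε : |ε| < 1) :
    torusKatokZiller ε = fun _ => randersNorm ε := by
  ext q v
  rw [torusKatokZiller, katokZiller, katokZillerHamiltonian_eq]
  exact torusHamiltonian_eq_randersNorm hε
    (Function.invFun_eq (exists_legendre_torusHamiltonian_eq hε v))

/-! ### Derivatives and strong convexity of the Randers norm -/

/-- The coordinate covectors `dx` (`i = 0`) and `dy` (`i = 1`). -/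
abbrev coframe (i : Fin 2) : Plane →L[ℝ] ℝ := EuclideanSpace.proj i

/-- The Euclidean part `√(v₀² + (1 - ε²) v₁²)` of the Randers norm. -/
def radial (ε : ℝ) (v : Plane) : ℝ := √(v 0 ^ 2 + (1 - ε ^ 2) * v 1 ^ 2)

/-- The partial derivatives of the Randers norm. -/
def momentum (ε : ℝ) (i : Fin 2) (v : Plane) : ℝ :=
  ![1 / (1 - ε ^ 2) * (v 0 / radial ε v - ε), v 1 / radial ε v] i

theorem momentum_zero (ε : ℝ) (v : Plane) :
    momentum ε 0 v = 1 / (1 - ε ^ 2) * (v 0 / radial ε v - ε) := rfl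

theorem momentum_one (ε : ℝ) (v : Plane) : momentum ε 1 v = v 1 / radial ε v := rfl

theorem randersNorm_eq (ε : ℝ) (v : Plane) :
    randersNorm ε v = 1 / (1 - ε ^ 2) * (radial ε v - ε * v 0) := rfl

theorem radial_pos {ε : ℝ} (hε : |ε| < 1) {v : Plane} (hv : v ≠ 0) : 0 < radial ε v :=
  Real.sqrt_pos.2 (sq_add_mul_sq_pos (one_sub_sq_pos hε) hv)

theorem radial_sq {ε : ℝ} (hε : |ε| < 1) (v : Plane) :
    radial ε v ^ 2 = v 0 ^ 2 + (1 - ε ^ 2) * v 1 ^ 2 := by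
  have := one_sub_sq_pos hε
  exact Real.sq_sqrt (by positivity)

theorem hasFDerivAt_coord (i : Fin 2) (v : Plane) :
    HasFDerivAt (fun v : Plane => v i) (coframe i) v :=
  (coframe i).hasFDerivAt

theorem hasFDerivAt_radial {ε : ℝ} (hε : |ε| < 1) {v : Plane} (hv : v ≠ 0) :
    HasFDerivAt (radial ε) ((v 0 / radial ε v) • coframe 0 +
      ((1 - ε ^ 2) * v 1 / radial ε v) • coframe 1) v := by
  have hD := radial_pos hε hv
  have h := (((hasFDerivAt_coord 0 v).pow 2).add
    (((hasFDerivAt_coord 1 v).pow 2).const_mul (1 - ε ^ 2))).sqrt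
      (sq_add_mul_sq_pos (one_sub_sq_pos hε) hv).ne'
  refine HasFDerivAt.congr_fderiv h ?_
  ext w
  have e : √(v 0 ^ 2 + (1 - ε ^ 2) * v 1 ^ 2) = radial ε v := rfl
  simp [e]
  field_simp

theorem hasFDerivAt_randersNorm {ε : ℝ} (hε : |ε| < 1) {v : Plane} (hv : v ≠ 0) :
    HasFDerivAt (randersNorm ε) (momentum ε 0 v • coframe 0 + momentum ε 1 v • coframe 1) v := by
  have ha := one_sub_sq_pos hε
  have hD := radial_pos hε hv
  have h := ((hasFDerivAt_radial hε hv).sub ((hasFDerivAt_coord 0 v).const_mul ε)).const_mul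
    (1 / (1 - ε ^ 2))
  refine HasFDerivAt.congr_fderiv h ?_
  ext w
  simp [momentum_zero, momentum_one]
  field_simp
  ring

theorem hasFDerivAt_momentum_zero {ε : ℝ} (hε : |ε| < 1) {v : Plane} (hv : v ≠ 0) :
    HasFDerivAt (momentum ε 0)
      ((v 1 / radial ε v ^ 3) • (v 1 • coframe 0 - v 0 • coframe 1)) v := by
  have ha := one_sub_sq_pos hε
  have hD := radial_pos hε hv
  have h := (((hasFDerivAt_coord 0 v).mul ((hasDerivAt_inv hD.ne').comp_hasFDerivAt v (hasFDerivAt_radial hε hv))).sub_const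
    ε).const_mul (1 / (1 - ε ^ 2))
  refine HasFDerivAt.congr_fderiv h ?_
  ext w
  simp
  field_simp
  rw [radial_sq hε]
  ring

theorem hasFDerivAt_momentum_one {ε : ℝ} (hε : |ε| < 1) {v : Plane} (hv : v ≠ 0) :
    HasFDerivAt (momentum ε 1)
      ((v 0 / radial ε v ^ 3) • (v 0 • coframe 1 - v 1 • coframe 0)) v := by
  have ha := one_sub_sq_pos hε
  have hD := radial_pos hε hv
  have h := ((hasFDerivAt_coord 1 v).mul ((hasDerivAt_inv hD.ne').comp_hasFDerivAt v (hasFDerivAt_radial hε hv)))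
  refine HasFDerivAt.congr_fderiv h ?_
  ext w
  simp
  field_simp
  rw [radial_sq hε]
  ring

theorem momentum_euler {ε : ℝ} (hε : |ε| < 1) {v : Plane} (hv : v ≠ 0) :
    v 0 * momentum ε 0 v + v 1 * momentum ε 1 v = randersNorm ε v := by
  have ha := one_sub_sq_pos hε
  have hD := radial_pos hε hv
  rw [momentum_zero, momentum_one, randersNorm_eq]
  field_simp
  linear_combination - radial_sq hε v

theorem continuous_randersNorm (ε : ℝ) : Continuous (randersNorm ε) := by
  unfold randersNorm
  fun_prop

theorem contDiffAt_randersNorm {ε : ℝ} (hε : |ε| < 1) {v : Plane} (hv : v ≠ 0) :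
    ContDiffAt ℝ ∞ (randersNorm ε) v := by
  have h0 : ∀ i, ContDiffAt ℝ ∞ (fun v : Plane => v i) v := fun i => (coframe i).contDiff.contDiffAt
  have hD := sq_add_mul_sq_pos (one_sub_sq_pos hε) hv
  exact contDiffAt_const.mul ((((((h0 0).pow 2).add
    (contDiffAt_const.mul ((h0 1).pow 2))).sqrt hD.ne')).sub (contDiffAt_const.mul (h0 0)))

/-- The Hessian of `F²` is `2 (dF ⊗ dF + F · Hess F)`. By homogeneity `Hess F` kills `v`, so in
dimension two it is a multiple of the squared determinant of `(v, w)`. -/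
theorem iteratedFDeriv_randersNorm_sq {ε : ℝ} (hε : |ε| < 1) {v : Plane} (hv : v ≠ 0) (w : Plane) :
    iteratedFDeriv ℝ 2 (fun u => randersNorm ε u ^ 2) v ![w, w] =
      2 * ((momentum ε 0 v * w 0 + momentum ε 1 v * w 1) ^ 2 +
        randersNorm ε v * ((v 0 * w 1 - v 1 * w 0) ^ 2 / radial ε v ^ 3)) := by
  rw [iteratedFDeriv_two_apply]
  have hev : fderiv ℝ (fun u => randersNorm ε u ^ 2) =ᶠ[nhds v] fun u =>
      (2 * randersNorm ε u) • (momentum ε 0 u • coframe 0 + momentum ε 1 u • coframe 1) := by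
    filter_upwards [isOpen_ne.mem_nhds hv] with u hu
    rw [((hasFDerivAt_randersNorm hε hu).pow 2).fderiv]
    simp
  have h := ((hasFDerivAt_randersNorm hε hv).const_mul 2).smul
    (((hasFDerivAt_momentum_zero hε hv).smul_const (coframe 0)).add
      ((hasFDerivAt_momentum_one hε hv).smul_const (coframe 1)))
  rw [hev.fderiv_eq]
  erw [h.fderiv]
  simp
  ring

theorem isFinslerMetric_randersNorm {ε : ℝ} (hε : |ε| < 1) :
    IsFinslerMetric (fun _ => randersNorm ε) where
  continuous := (continuous_randersNorm ε).comp continuous_snd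
  smooth := fun p hp =>
    ((contDiffAt_randersNorm hε hp).comp p contDiffAt_snd).contDiffWithinAt
  homogeneous := fun _ v c hc => by
    have : (c * v 0) ^ 2 + (1 - ε ^ 2) * (c * v 1) ^ 2 =
      c ^ 2 * (v 0 ^ 2 + (1 - ε ^ 2) * v 1 ^ 2) := by ring
    simp only [randersNorm, PiLp.smul_apply, smul_eq_mul]
    rw [this, Real.sqrt_mul (sq_nonneg c), Real.sqrt_sq hc.le]
    ring
  nonneg := fun _ v => by
    by_cases hv : v = 0
    · simp [hv, randersNorm]
    · exact (randersNorm_pos hε hv).le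
  eq_zero_iff := fun _ v => by
    refine ⟨fun h => ?_, fun h => by simp [h, randersNorm]⟩
    by_contra hv
    exact (randersNorm_pos hε hv).ne' h
  stronglyConvex := fun _ v hv w hw => by
    rw [iteratedFDeriv_randersNorm_sq hε hv]
    have hF := randersNorm_pos hε hv
    have hD := radial_pos hε hv
    have h1 := sq_nonneg (momentum ε 0 v * w 0 + momentum ε 1 v * w 1)
    -- If the determinant vanishes, `w` is parallel to `v`; were `dF(w) = 0` too, Euler's relation
    -- `dF(v) = F(v) > 0` would force `w = 0`.
    by_cases hx : v 0 * w 1 - v 1 * w 0 = 0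
    · refine mul_pos two_pos (add_pos_of_pos_of_nonneg ?_ (by positivity))
      refine lt_of_le_of_ne h1 fun h => hw ?_
      have hP : momentum ε 0 v * w 0 + momentum ε 1 v * w 1 = 0 := by
        simpa using h.symm
      have he := momentum_euler hε hv
      have e0 : w 0 * randersNorm ε v = 0 := by
        rw [← he]
        linear_combination v 0 * hP - momentum ε 1 v * hx
      have e1 : w 1 * randersNorm ε v = 0 := by
        rw [← he]
        linear_combination v 1 * hP + momentum ε 0 v * hx
      apply plane_ext
      · simpa [hF.ne'] using e0
      · simpa [hF.ne'] using e1
    · have : 0 < (v 0 * w 1 - v 1 * w 0) ^ 2 := by positivity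
      positivity

/-! ### The Hilbert form and its Reeb field -/

theorem dir_coe (t : ℝ) : dir (t : Real.Angle) = !₂[Real.cos t, Real.sin t] := by
  simp [dir]

theorem dir_sq (θ : Real.Angle) : dir θ 0 ^ 2 + dir θ 1 ^ 2 = 1 := by
  simp [dir, Real.Angle.cos_sq_add_sin_sq]

theorem dir_ne_zero (θ : Real.Angle) : dir θ ≠ 0 := by
  intro h
  have := dir_sq θ
  simp [h] at this

/-- The differential of a momentum along the circle of directions. -/
def momentumDeriv (ε : ℝ) (i : Fin 2) (v : Plane) : ℝ :=
  ![-v 1 / radial ε v ^ 3, v 0 / radial ε v ^ 3] i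

theorem hasDerivAt_momentum_dir {ε : ℝ} (hε : |ε| < 1) (i : Fin 2) (t : ℝ) :
    HasDerivAt (fun t : ℝ => momentum ε i (dir t)) (momentumDeriv ε i (dir t)) t := by
  have hne : dir t ≠ 0 := dir_ne_zero _
  have hγ : HasDerivAt (fun t : ℝ => dir (t : Real.Angle))
      (-Real.sin t • frame 0 + Real.cos t • frame 1) t := by
    have heq : (fun t : ℝ => dir (t : Real.Angle)) =
        fun t => Real.cos t • frame 0 + Real.sin t • frame 1 := by
      ext1 t
      rw [plane_eq_frame (dir t), dir_coe]
      rfl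
    rw [heq]
    exact ((Real.hasDerivAt_cos t).smul_const _).add ((Real.hasDerivAt_sin t).smul_const _)
  have h1 := Real.sin_sq_add_cos_sq t
  have hR := radial_pos hε hne
  fin_cases i
  · refine ((hasFDerivAt_momentum_zero hε hne).comp_hasDerivAt t hγ).congr_deriv ?_
    simp [momentumDeriv, dir_coe]
    rw [← dir_coe]
    field_simp
    linear_combination (-Real.sin t) * h1
  · refine ((hasFDerivAt_momentum_one hε hne).comp_hasDerivAt t hγ).congr_deriv ?_
    simp [momentumDeriv, dir_coe]
    rw [← dir_coe]
    field_simp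
    linear_combination (Real.cos t) * h1

/-- The pullbacks to `H𝕋` of `dx` and `dy`. -/
def baseForm (i : Fin 2) : HModel [⋀^Fin 1]→L[ℝ] ℝ :=
  ContinuousAlternatingMap.ofSubsingleton ℝ HModel ℝ (0 : Fin 1) ((coframe i).comp dπ)

theorem baseForm_apply (i : Fin 2) (v : Fin 1 → HModel) : baseForm i v = (v 0).1 i := rfl

theorem hilbertForm_randersNorm {ε : ℝ} (hε : |ε| < 1) (h : HTorus) :
    hilbertForm (fun _ => randersNorm ε) h =
      momentum ε 0 (dir h.2) • baseForm 0 + momentum ε 1 (dir h.2) • baseForm 1 := by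
  rw [hilbertForm, (hasFDerivAt_randersNorm hε (dir_ne_zero h.2)).fderiv]
  ext v
  rfl

theorem hilbertForm_apply {ε : ℝ} (hε : |ε| < 1) (h : HTorus) (v : Fin 1 → HModel) :
    hilbertForm (fun _ => randersNorm ε) h v =
      momentum ε 0 (dir h.2) * (v 0).1 0 + momentum ε 1 (dir h.2) * (v 0).1 1 := by
  rw [hilbertForm_randersNorm hε]
  rfl

/-- The coefficients of `A` depend only on the angle, so `dA = P₀' dt ∧ dx + P₁' dt ∧ dy`. -/
theorem d_hilbertForm_apply {ε : ℝ} (hε : |ε| < 1) (h : HTorus) (v : Fin 2 → HModel) :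
    (hilbertForm (fun _ => randersNorm ε)).d h v =
      momentumDeriv ε 0 (dir h.2) * ((v 0).2 * (v 1).1 0 - (v 1).2 * (v 0).1 0) +
      momentumDeriv ε 1 (dir h.2) * ((v 0).2 * (v 1).1 1 - (v 1).2 * (v 0).1 1) := by
  obtain ⟨q, θ⟩ := h
  obtain ⟨t, rfl⟩ : ∃ t : ℝ, (t : Real.Angle) = θ := QuotientAddGroup.mk_surjective θ
  have hsnd : HasFDerivAt (fun u : HModel => t + u.2) (ContinuousLinearMap.snd ℝ Plane ℝ) 0 :=
    hasFDerivAt_snd.const_add t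
  have hm : ∀ i, HasFDerivAt (fun u : HModel => momentum ε i (dir ((t + u.2 : ℝ) : Real.Angle)))
      (momentumDeriv ε i (dir (t : Real.Angle)) • ContinuousLinearMap.snd ℝ Plane ℝ) 0 := by
    intro i
    have := hasDerivAt_momentum_dir hε i (t + (0 : HModel).2)
    have := this.comp_hasFDerivAt (0 : HModel) hsnd
    simpa [Function.comp_def] using this
  have hd := ((hm 0).smul_const (baseForm 0)).add ((hm 1).smul_const (baseForm 1))
  have heq : (fun u : HModel => hilbertForm (fun _ => randersNorm ε)
      (((q, (t : Real.Angle)) : HTorus) + toH u)) = fun u : HModel =>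
      momentum ε 0 (dir ((t + u.2 : ℝ) : Real.Angle)) • baseForm 0 +
        momentum ε 1 (dir ((t + u.2 : ℝ) : Real.Angle)) • baseForm 1 := by
    ext1 u
    rw [hilbertForm_randersNorm hε]
    simp [toH]
  change extDeriv (fun u : HModel => hilbertForm (fun _ => randersNorm ε)
      (((q, (t : Real.Angle)) : HTorus) + toH u)) 0 v = _
  have hfd : fderiv ℝ (fun u : HModel =>
      momentum ε 0 (dir ((t + u.2 : ℝ) : Real.Angle)) • baseForm 0 +
        momentum ε 1 (dir ((t + u.2 : ℝ) : Real.Angle)) • baseForm 1) 0 = _ := hd.fderiv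
  rw [heq, extDeriv, ContinuousAlternatingMap.alternatizeUncurryFin_apply, hfd]
  simp [Fin.sum_univ_two, baseForm_apply, Fin.removeNth]
  ring

/-- The unit vector field `dir θ / F (dir θ)`, lifted horizontally to `H𝕋`. -/
def unitField (ε : ℝ) (θ : Real.Angle) : Plane := (randersNorm ε (dir θ))⁻¹ • dir θ

/-- Pairing `dA` with `∂/∂x` and `∂/∂y` kills the vertical component, because `P'` is a nonzero
multiple of `(-sin, cos)`. Pairing with `∂/∂t` makes the horizontal part parallel to `dir`; then
`A(X) = 1` and Euler's relation fix its length. The equivalence supplies both the existence and the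
uniqueness needed to evaluate `Classical.epsilon`. -/
theorem isReebField_iff {ε : ℝ} (hε : |ε| < 1) (X : HTorus → HModel) :
    IsReebField (fun _ => randersNorm ε) X ↔ X = fun h => (unitField ε h.2, 0) := by
  have key : ∀ h : HTorus, ∀ Y : HModel, (hilbertForm (fun _ => randersNorm ε) h ![Y] = 1 ∧
      ∀ w, (hilbertForm (fun _ => randersNorm ε)).d h ![Y, w] = 0) ↔ Y = (unitField ε h.2, 0) := by
    intro h Y
    have hv := dir_ne_zero h.2
    have hR := radial_pos hε hv
    have hF := randersNorm_pos hε hv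
    have hE := momentum_euler hε hv
    have h1 := dir_sq h.2
    simp only [hilbertForm_apply hε, d_hilbertForm_apply hε, momentumDeriv, Matrix.cons_val_zero,
      Matrix.cons_val_one, unitField]
    generalize dir h.2 = e at *
    constructor
    · rintro ⟨hA, hd⟩
      have d0 := hd (frame 0, 0)
      have d1 := hd (frame 1, 0)
      have d2 := hd (0, 1)
      simp [hR.ne'] at d0 d1 d2
      field_simp at d2
      have hY : Y.2 = 0 := by
        rcases d0 with d0 | d0
        · rcases d1 with d1 | d1
          · simp [d0, d1] at h1
          · exact d1
        · exact d0
      refine Prod.ext (plane_ext ?_ ?_) hY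
      · simp
        field_simp
        rw [← hE]
        linear_combination e 0 * hA + momentum ε 1 e * d2
      · simp
        field_simp
        rw [← hE]
        linear_combination e 1 * hA - momentum ε 0 e * d2
    · rintro rfl
      refine ⟨?_, fun w => ?_⟩
      · simp
        field_simp
        linear_combination hE
      · simp
        ring
  refine ⟨fun h => funext fun x => (key x _).1 (h x), fun h x => (key x _).2 (by rw [h])⟩

theorem reebField_randersNorm {ε : ℝ} (hε : |ε| < 1) :
    reebField (fun _ => randersNorm ε) = fun h => (unitField ε h.2, 0) :=
  (isReebField_iff hε _).1 (Classical.epsilon_spec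
    (p := IsReebField (fun _ => randersNorm ε)) ⟨_, (isReebField_iff hε _).2 rfl⟩)

/-! ### Integrals over the circle of directions -/

theorem integral_eq_zero_of_antiperiodic {g : ℝ → ℝ} (hg : Continuous g)
    (h : Function.Antiperiodic g π) : ∫ t in (0 : ℝ)..(2 * π), g t = 0 := by
  rw [← intervalIntegral.integral_add_adjacent_intervals (b := π) (hg.intervalIntegrable _ _)
    (hg.intervalIntegrable _ _)]
  have h2 : ∫ t in π..(2 * π), g t = ∫ t in (0 : ℝ)..π, g (t + π) := by
    rw [intervalIntegral.integral_comp_add_right]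
    congr 1 <;> ring
  rw [h2, intervalIntegral.integral_congr (g := fun t => - g t) fun t _ => h t,
    intervalIntegral.integral_neg, add_neg_cancel]

/-- The Euclidean part of the Randers norm on the unit circle. -/
def circleRadius (ε t : ℝ) : ℝ := radial ε (dir (t : Real.Angle))

theorem circleRadius_eq (ε t : ℝ) :
    circleRadius ε t = √(Real.cos t ^ 2 + (1 - ε ^ 2) * Real.sin t ^ 2) := by
  simp [circleRadius, dir_coe, radial]

theorem circleRadius_pos {ε : ℝ} (hε : |ε| < 1) (t : ℝ) : 0 < circleRadius ε t :=
  radial_pos hε (dir_ne_zero _)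

theorem circleRadius_sq {ε : ℝ} (hε : |ε| < 1) (t : ℝ) :
    circleRadius ε t ^ 2 = Real.cos t ^ 2 + (1 - ε ^ 2) * Real.sin t ^ 2 := by
  rw [circleRadius, radial_sq hε, dir_coe]
  simp

theorem continuous_circleRadius (ε : ℝ) : Continuous (circleRadius ε) := by
  have : circleRadius ε = fun t => √(Real.cos t ^ 2 + (1 - ε ^ 2) * Real.sin t ^ 2) :=
    funext (circleRadius_eq ε)
  rw [this]
  fun_prop

theorem circleRadius_add_pi (ε t : ℝ) : circleRadius ε (t + π) = circleRadius ε t := by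
  simp [circleRadius_eq]

theorem contDiff_circleRadius {ε : ℝ} (hε : |ε| < 1) : ContDiff ℝ ∞ (circleRadius ε) := by
  have : circleRadius ε = fun t => √(Real.cos t ^ 2 + (1 - ε ^ 2) * Real.sin t ^ 2) :=
    funext (circleRadius_eq ε)
  rw [this]
  refine ContDiff.sqrt (by fun_prop) fun t => ?_
  rw [← circleRadius_sq hε]
  exact (pow_pos (circleRadius_pos hε t) 2).ne'

theorem integral_inv_circleRadius_sq {ε : ℝ} (hε : |ε| < 1) :
    ∫ t in (0 : ℝ)..(2 * π), 1 / circleRadius ε t ^ 2 = 2 * π / √(1 - ε ^ 2) := by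
  have ha := one_sub_sq_pos hε
  have hs := Real.sqrt_pos.2 ha
  have hs2 := Real.sq_sqrt ha.le
  set s := √(1 - ε ^ 2) with hsdef
  have hden : ∀ t, 0 < Real.cos t ^ 2 + s * Real.sin t ^ 2 := by
    intro t
    have h1 := Real.sin_sq_add_cos_sq t
    by_cases h : Real.cos t = 0
    · simp only [h] at h1 ⊢
      nlinarith
    · have : 0 < Real.cos t ^ 2 := by positivity
      nlinarith [mul_nonneg hs.le (sq_nonneg (Real.sin t))]
  -- The usual primitive `s⁻¹ arctan (s tan t)` jumps at `π / 2`. Combining `arctan (s tan t) - t`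
  -- into a single arctangent by the subtraction formula gives a primitive smooth on the whole line,
  -- whose arctangent part is periodic.
  have hderiv : ∀ t ∈ Set.uIcc 0 (2 * π), HasDerivAt (fun t => s⁻¹ * (t + Real.arctan
      ((s - 1) * (Real.sin t * Real.cos t) / (Real.cos t ^ 2 + s * Real.sin t ^ 2))))
      (1 / circleRadius ε t ^ 2) t := by
    intro t _
    have hsin := Real.hasDerivAt_sin t
    have hcos := Real.hasDerivAt_cos t
    have h := ((hasDerivAt_id t).add ((((hsin.mul hcos).const_mul (s - 1)).div
      ((hcos.pow 2).add ((hsin.pow 2).const_mul s)) (hden t).ne').arctan)).const_mul s⁻¹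
    refine h.congr_deriv ?_
    have hR : 0 < circleRadius ε t ^ 2 := pow_pos (circleRadius_pos hε t) 2
    have hd := hden t
    have h1 := Real.sin_sq_add_cos_sq t
    rw [circleRadius_sq hε, ← hs2] at *
    simp
    set c := Real.cos t
    set k := Real.sin t
    have hdd : 0 < (c ^ 2 + s * k ^ 2) ^ 2 + ((s - 1) * (k * c)) ^ 2 := by positivity
    -- The left side factors as `(c² + s² k²)(c² + k²)`.
    have hkey : (c ^ 2 + s * k ^ 2) ^ 2 + ((s - 1) * (k * c)) ^ 2 = c ^ 2 + s ^ 2 * k ^ 2 := by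
      linear_combination (c ^ 2 + s ^ 2 * k ^ 2) * h1
    have e1 : 1 + ((s - 1) * (k * c) / (c ^ 2 + s * k ^ 2)) ^ 2 =
        (c ^ 2 + s ^ 2 * k ^ 2) / (c ^ 2 + s * k ^ 2) ^ 2 := by
      rw [← hkey]
      field_simp
    rw [e1]
    field_simp
    have hc2 : c ^ 2 = 1 - k ^ 2 := by linarith
    have hc4 : c ^ 4 = (1 - k ^ 2) ^ 2 := by rw [← hc2]; ring
    ring_nf
    simp only [hc2, hc4]
    ring
  rw [intervalIntegral.integral_eq_sub_of_hasDerivAt hderiv]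
  · simp
    field_simp
  · refine (Continuous.div₀ continuous_const ((continuous_circleRadius ε).pow 2) fun t =>
      (pow_pos (circleRadius_pos hε t) 2).ne').intervalIntegrable _ _

theorem continuous_div_circleRadius {ε : ℝ} (hε : |ε| < 1) {g : ℝ → ℝ} (hg : Continuous g) (n : ℕ) :
    Continuous fun t => g t / circleRadius ε t ^ n :=
  hg.div₀ ((continuous_circleRadius ε).pow n) fun t => (pow_pos (circleRadius_pos hε t) n).ne'

theorem integral_cos_sq_add_sin_sq_div {ε : ℝ} (hε : |ε| < 1) (x y : ℝ) :
    ∫ t in (0 : ℝ)..(2 * π), (x * Real.cos t ^ 2 + y * Real.sin t ^ 2) / circleRadius ε t ^ 2 =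
      x * (∫ t in (0 : ℝ)..(2 * π), Real.cos t ^ 2 / circleRadius ε t ^ 2) +
      y * (∫ t in (0 : ℝ)..(2 * π), Real.sin t ^ 2 / circleRadius ε t ^ 2) := by
  have hc := continuous_div_circleRadius hε (g := fun t => Real.cos t ^ 2) (by fun_prop) 2
  have hs := continuous_div_circleRadius hε (g := fun t => Real.sin t ^ 2) (by fun_prop) 2
  rw [← intervalIntegral.integral_const_mul, ← intervalIntegral.integral_const_mul,
    ← intervalIntegral.integral_add ((hc.const_mul x).intervalIntegrable _ _)
      ((hs.const_mul y).intervalIntegrable _ _)]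
  congr 1
  ext t
  ring

/-- The two integrals `x`, `y` solve the linear system `x + y = 2π / s`, `x + s² y = 2π`, where `s =
√(1 - ε²)`. -/
theorem integral_sq_div_circleRadius_sq {ε : ℝ} (hε : |ε| < 1) :
    ∫ t in (0 : ℝ)..(2 * π), Real.cos t ^ 2 / circleRadius ε t ^ 2 =
        2 * π / (1 + √(1 - ε ^ 2)) ∧
    ∫ t in (0 : ℝ)..(2 * π), Real.sin t ^ 2 / circleRadius ε t ^ 2 =
        2 * π / (√(1 - ε ^ 2) * (1 + √(1 - ε ^ 2))) := by
  have ha := one_sub_sq_pos hε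
  have hs := Real.sqrt_pos.2 ha
  have hs2 := Real.sq_sqrt ha.le
  have hsum := integral_cos_sq_add_sin_sq_div hε 1 1
  have hone := integral_cos_sq_add_sin_sq_div hε 1 (1 - ε ^ 2)
  simp only [one_mul, Real.cos_sq_add_sin_sq, integral_inv_circleRadius_sq hε] at hsum
  have h1 : ∀ t, (Real.cos t ^ 2 + (1 - ε ^ 2) * Real.sin t ^ 2) / circleRadius ε t ^ 2 = 1 := by
    intro t
    rw [← circleRadius_sq hε, div_self (pow_pos (circleRadius_pos hε t) 2).ne']
  simp only [one_mul, h1, intervalIntegral.integral_const, sub_zero, smul_eq_mul, mul_one] at hone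
  -- For `ε = 0` one has `s = 1` and the two equations coincide; the integrals are then the
  -- classical ones.
  by_cases h0 : ε = 0
  · subst h0
    have hR : ∀ t, circleRadius 0 t = 1 := by simp [circleRadius_eq, Real.cos_sq_add_sin_sq]
    norm_num [hR]
  · set s := √(1 - ε ^ 2)
    set x := ∫ t in (0 : ℝ)..(2 * π), Real.cos t ^ 2 / circleRadius ε t ^ 2
    set y := ∫ t in (0 : ℝ)..(2 * π), Real.sin t ^ 2 / circleRadius ε t ^ 2
    rw [← hs2] at hone
    have hs1 : s ≠ 1 := by
      intro h
      rw [h] at hs2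
      apply h0
      nlinarith
    have hy : y = 2 * π / (s * (1 + s)) := by
      have : (1 - s) * (y * (s * (1 + s)) - 2 * π) = 0 := by
        have : y * (1 - s ^ 2) * s = 2 * π * (1 - s) := by
          have e : 2 * π = (x + y) * s := by rw [← hsum]; field_simp
          linear_combination s * hone - e
        linear_combination this
      rcases mul_eq_zero.1 this with h | h
      · exact absurd (by linarith) hs1
      · field_simp
        linarith
    refine ⟨?_, hy⟩
    have : x = 2 * π / s - y := by linarith
    rw [this, hy]
    field_simp
    ring

theorem integral_sin_mul_cos_div_circleRadius_sq (ε : ℝ) :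
    ∫ t in (0 : ℝ)..(2 * π), Real.cos t * Real.sin t / circleRadius ε t ^ 2 = 0 := by
  have h := intervalIntegral.integral_comp_sub_left (a := 0) (b := 2 * π)
    (fun t => Real.cos t * Real.sin t / circleRadius ε t ^ 2) (2 * π)
  have h2 : ∀ t, Real.cos (2 * π - t) * Real.sin (2 * π - t) / circleRadius ε (2 * π - t) ^ 2 =
      - (Real.cos t * Real.sin t / circleRadius ε t ^ 2) := by
    intro t
    simp only [circleRadius_eq, Real.cos_two_pi_sub, Real.sin_two_pi_sub]
    rw [neg_sq]
    ring
  simp only [h2, intervalIntegral.integral_neg, sub_self, sub_zero] at h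
  linarith

/-- Under a half-turn `g` and `R` are invariant while `cos` changes sign, so the correction term
integrates to zero. -/
theorem integral_mul_one_add_cos_div {ε : ℝ} (hε : |ε| < 1) {g : ℝ → ℝ} (hg : Continuous g)
    (hper : ∀ t, g (t + π) = g t) :
    ∫ t in (0 : ℝ)..(2 * π), g t / circleRadius ε t ^ 2 * (1 + ε * Real.cos t / circleRadius ε t) =
      ∫ t in (0 : ℝ)..(2 * π), g t / circleRadius ε t ^ 2 := by
  have h1 := continuous_div_circleRadius hε hg 2
  have h2 := continuous_div_circleRadius hε (g := fun t => g t * (ε * Real.cos t)) (by fun_prop) 3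
  have hz := integral_eq_zero_of_antiperiodic h2 (by
    intro t
    simp only [hper, circleRadius_add_pi, Real.cos_add_pi]
    ring)
  have hadd := intervalIntegral.integral_add (μ := MeasureTheory.volume)
    (h1.intervalIntegrable 0 (2 * π)) (h2.intervalIntegrable 0 (2 * π))
  rw [hz, add_zero] at hadd
  rw [← hadd]
  congr 1
  ext t
  have := circleRadius_pos hε t
  field_simp

/-! ### The angle form -/

/-- The density of the angle form of the Katok–Ziller metric along the fibres of `H𝕋`. -/
def angleDensity (ε t : ℝ) : ℝ :=
  √(1 - ε ^ 2) * (circleRadius ε t - ε * Real.cos t) / circleRadius ε t ^ 3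

theorem circleRadius_sub_pos {ε : ℝ} (hε : |ε| < 1) (t : ℝ) :
    0 < circleRadius ε t - ε * Real.cos t := by
  have h := randersNorm_pos hε (dir_ne_zero t)
  rw [randersNorm_eq, dir_coe] at h
  have ha := one_sub_sq_pos hε
  have := (pos_iff_pos_of_mul_pos h).1 (by positivity)
  simpa [circleRadius, dir_coe] using this

theorem angleDensity_pos {ε : ℝ} (hε : |ε| < 1) (t : ℝ) : 0 < angleDensity ε t := by
  have ha := one_sub_sq_pos hε
  have := circleRadius_sub_pos hε t
  have := circleRadius_pos hε t
  have := Real.sqrt_pos.2 ha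
  rw [angleDensity]
  positivity

theorem contDiff_angleDensity {ε : ℝ} (hε : |ε| < 1) : ContDiff ℝ ∞ (angleDensity ε) := by
  have h := contDiff_circleRadius hε
  refine ContDiff.div (contDiff_const.mul (h.sub (contDiff_const.mul Real.contDiff_cos)))
    (h.pow 3) fun t => (pow_pos (circleRadius_pos hε t) 3).ne'

theorem integral_angleDensity {ε : ℝ} (hε : |ε| < 1) :
    ∫ t in (0 : ℝ)..(2 * π), angleDensity ε t = 2 * π := by
  have ha := one_sub_sq_pos hε
  have hs := Real.sqrt_pos.2 ha
  have h1 := continuous_div_circleRadius hε (g := fun _ => 1) (by fun_prop) 2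
  have h2 := continuous_div_circleRadius hε (g := fun t => Real.cos t) (by fun_prop) 3
  have hz := integral_eq_zero_of_antiperiodic h2 (by
    intro t
    simp only [circleRadius_add_pi, Real.cos_add_pi]
    ring)
  have heq : angleDensity ε = fun t => √(1 - ε ^ 2) * (1 / circleRadius ε t ^ 2) -
      √(1 - ε ^ 2) * ε * (Real.cos t / circleRadius ε t ^ 3) := by
    ext t
    have := circleRadius_pos hε t
    rw [angleDensity]
    field_simp
  rw [heq, intervalIntegral.integral_sub ((h1.const_mul _).intervalIntegrable _ _)
    ((h2.const_mul _).intervalIntegrable _ _), intervalIntegral.integral_const_mul,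
    intervalIntegral.integral_const_mul, hz, integral_inv_circleRadius_sq hε]
  field_simp
  ring

/-- This Wronskian is, up to sign, the coefficient of `A ∧ dA`; hence the shape of the angle
density. -/
theorem momentum_wronskian {ε : ℝ} (hε : |ε| < 1) (t : ℝ) :
    momentum ε 0 (dir t) * momentumDeriv ε 1 (dir t) -
      momentum ε 1 (dir t) * momentumDeriv ε 0 (dir t) =
      angleDensity ε t / ((1 - ε ^ 2) * √(1 - ε ^ 2)) := by
  have ha := one_sub_sq_pos hε
  have hs := Real.sqrt_pos.2 ha
  have hR := circleRadius_pos hε t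
  have hR2 := circleRadius_sq hε t
  rw [momentum_zero, momentum_one, angleDensity]
  change _ * (_ / circleRadius ε t - _) * (_ / circleRadius ε t ^ 3) -
    _ / circleRadius ε t * (_ / circleRadius ε t ^ 3) = _
  simp only [dir_coe, Matrix.cons_val_zero, Matrix.cons_val_one, PiLp.toLp_apply]
  field_simp
  linear_combination - hR2

/-- The `1`-form `dt` on `H𝕋`. -/
def fibreForm : HModel [⋀^Fin 1]→L[ℝ] ℝ :=
  ContinuousAlternatingMap.ofSubsingleton ℝ HModel ℝ (0 : Fin 1) (ContinuousLinearMap.snd ℝ Plane ℝ)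

theorem fibreForm_apply (v : Fin 1 → HModel) : fibreForm v = (v 0).2 := rfl

/-- The area form `dx ∧ dy` of the plane. -/
def areaForm : Plane [⋀^Fin 2]→L[ℝ] ℝ :=
  ContinuousAlternatingMap.alternatizeUncurryFin ((coframe 0).smulRight
    (ContinuousAlternatingMap.ofSubsingleton ℝ Plane ℝ (0 : Fin 1) (coframe 1)))

theorem areaForm_apply (v : Fin 2 → Plane) : areaForm v = v 0 0 * v 1 1 - v 1 0 * v 0 1 := by
  rw [areaForm, ContinuousAlternatingMap.alternatizeUncurryFin_apply]
  simp [Fin.sum_univ_two, Fin.removeNth]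
  ring

theorem wedge_apply (η : HModel [⋀^Fin 1]→L[ℝ] ℝ) (β : HModel [⋀^Fin 2]→L[ℝ] ℝ)
    (v : Fin 3 → HModel) : wedge η β v =
      η ![v 0] * β ![v 1, v 2] - η ![v 1] * β ![v 0, v 2] + η ![v 2] * β ![v 0, v 1] := by
  have h0 : (0 : Fin 3).removeNth v = ![v 1, v 2] := by
    ext1 i; fin_cases i <;> rfl
  have h1 : (1 : Fin 3).removeNth v = ![v 0, v 2] := by
    ext1 i; fin_cases i <;> rfl
  have h2 : (2 : Fin 3).removeNth v = ![v 0, v 1] := by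
    ext1 i; fin_cases i <;> rfl
  simp [wedge, Fin.sum_univ_three, h0, h1, h2]
  ring

theorem exists_isAngleVolumePair {ε : ℝ} (hε : |ε| < 1) :
    ∃ α Ω, IsAngleVolumePair (fun _ => randersNorm ε) α Ω := by
  have ha := one_sub_sq_pos hε
  have hs := Real.sqrt_pos.2 ha
  have hper : Function.Periodic (angleDensity ε) (2 * π) := fun t => by
    simp [angleDensity, circleRadius_eq]
  refine ⟨fun h => angleDensity ε h.2.toReal • fibreForm,
    -- The minus sign reflects the orientation: `A ∧ dA` is negative on `(∂/∂t, ∂/∂x, ∂/∂y)`, while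
    -- the fibres must have total angle `+2π`.
    fun _ => (-1 / ((1 - ε ^ 2) * √(1 - ε ^ 2))) • areaForm, ?_⟩
  -- Periodicity of the density hides the jump of `Real.Angle.toReal`, so the form is smooth.
  have htoReal : ∀ t : ℝ, angleDensity ε (t : Real.Angle).toReal = angleDensity ε t := by
    intro t
    obtain ⟨k, hk⟩ := Real.Angle.angle_eq_iff_two_pi_dvd_sub.1
      (Real.Angle.coe_toReal (t : Real.Angle))
    have : (t : Real.Angle).toReal = t + k * (2 * π) := by linarith
    rw [this, hper.int_mul k]
  refine ⟨?_, ?_, contDiff_const, ?_, ?_, ?_⟩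
  · simp only [toH, htoReal]
    exact ((contDiff_angleDensity hε).comp contDiff_snd).smul contDiff_const
  · intro h
    simpa [fibreForm_apply, vert] using (angleDensity_pos hε _).ne'
  · intro q h
    have := congrArg (fun β : Plane [⋀^Fin 2]→L[ℝ] ℝ => β ![frame 0, frame 1]) h
    simp [areaForm_apply, ha.ne', hs.ne'] at this
  · rintro ⟨q, θ⟩ v
    obtain ⟨t, rfl⟩ : ∃ t : ℝ, (t : Real.Angle) = θ := QuotientAddGroup.mk_surjective θ
    have hW := momentum_wronskian hε t
    simp only [wedge_apply, hilbertForm_apply hε, d_hilbertForm_apply hε, htoReal]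
    simp [fibreForm_apply, areaForm_apply, dπ]
    have hW' : angleDensity ε t * (-1 / ((1 - ε ^ 2) * √(1 - ε ^ 2))) =
        -(momentum ε 0 (dir t) * momentumDeriv ε 1 (dir t) -
      momentum ε 1 (dir t) * momentumDeriv ε 0 (dir t)) := by rw [hW]; ring
    linear_combination ((v 0).2 * ((v 1).1 0 * (v 2).1 1 - (v 2).1 0 * (v 1).1 1)
      - (v 1).2 * ((v 0).1 0 * (v 2).1 1 - (v 2).1 0 * (v 0).1 1)
      + (v 2).2 * ((v 0).1 0 * (v 1).1 1 - (v 1).1 0 * (v 0).1 1)) * hW'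
  · intro q
    simp only [htoReal]
    simpa [fibreForm_apply, vert] using integral_angleDensity hε

/-- Since `π^*Ω` kills vertical vectors, evaluating the wedge identity on `(∂/∂t, ∂/∂x, ∂/∂y)` gives
`α(∂/∂t)` times a quantity constant on the fibre. The total angle `2π` determines that constant. -/
theorem IsAngleVolumePair.apply_vert {ε : ℝ} (hε : |ε| < 1) {α : HForm 1}
    {Ω : Torus → Plane [⋀^Fin 2]→L[ℝ] ℝ} (h : IsAngleVolumePair (fun _ => randersNorm ε) α Ω)
    (q : Torus) (t : ℝ) : α (q, (t : Real.Angle)) ![vert] = angleDensity ε t := by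
  have ha := one_sub_sq_pos hε
  have hs := Real.sqrt_pos.2 ha
  set κ := (1 - ε ^ 2) * √(1 - ε ^ 2) with hκ
  have hκ0 : 0 < κ := by positivity
  have key : ∀ t : ℝ, α (q, (t : Real.Angle)) ![vert] * (Ω q ![frame 0, frame 1] * κ) =
      - angleDensity ε t := by
    intro t
    have hw := h.wedge_eq (q, (t : Real.Angle)) ![vert, (frame 0, 0), (frame 1, 0)]
    have hW := momentum_wronskian hε t
    have e0 : (⇑dπ ∘ ![((frame 0, 0) : HModel), (frame 1, 0)]) = ![frame 0, frame 1] := by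
      ext1 i; fin_cases i <;> rfl
    have e1 : ∀ w : HModel, Ω q (⇑dπ ∘ ![vert, w]) = 0 := fun w =>
      (Ω q).map_coord_zero 0 (by simp [vert, dπ])
    simp only [wedge_apply, hilbertForm_apply hε, d_hilbertForm_apply hε,
      ContinuousAlternatingMap.compContinuousLinearMap_apply, Matrix.cons_val_zero,
      Matrix.cons_val_one, Matrix.cons_val, e0, e1] at hw
    simp [vert] at hw
    have : angleDensity ε t = κ * (momentum ε 0 (dir t) * momentumDeriv ε 1 (dir t) -
      momentum ε 1 (dir t) * momentumDeriv ε 0 (dir t)) := by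
      rw [hW, ← hκ]
      field_simp
    rw [this]
    simp only [vert]
    linear_combination κ * hw
  have hint : Ω q ![frame 0, frame 1] * κ = -1 := by
    have h1 : ∫ t in (0 : ℝ)..(2 * π),
        α (q, (t : Real.Angle)) ![vert] * (Ω q ![frame 0, frame 1] * κ) = -(2 * π) := by
      simp only [key, intervalIntegral.integral_neg, integral_angleDensity hε]
    rw [intervalIntegral.integral_mul_const, h.total_angle] at h1
    have := Real.two_pi_pos.ne'
    apply mul_left_cancel₀ this
    linarith
  have := key t
  rw [hint] at this
  linarith

theorem angleForm_randersNorm {ε : ℝ} (hε : |ε| < 1) (q : Torus) (t : ℝ) :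
    angleForm (fun _ => randersNorm ε) (q, (t : Real.Angle)) ![vert] = angleDensity ε t := by
  obtain ⟨Ω, h⟩ : ∃ Ω, IsAngleVolumePair (fun _ => randersNorm ε)
      (angleForm (fun _ => randersNorm ε)) Ω :=
    Classical.epsilon_spec (p := fun α => ∃ Ω, IsAngleVolumePair (fun _ => randersNorm ε) α Ω)
      (exists_isAngleVolumePair hε)
  exact h.apply_vert hε q t

/-! ### Lie derivatives and the Laplacian -/

theorem toTorus_add (x y : Plane) : toTorus (x + y) = toTorus x + toTorus y := by
  ext1 i
  simp [toTorus]

theorem toTorus_surjective : Function.Surjective toTorus := by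
  intro q
  choose x hx using fun i => QuotientAddGroup.mk_surjective (q i)
  exact ⟨WithLp.toLp 2 x, funext hx⟩

theorem single_eq_smul_frame (i : Fin 2) (s : ℝ) :
    (EuclideanSpace.single i s : Plane) = s • frame i := by
  ext j
  simp

theorem torusPartial_toTorus {f : Torus → ℂ} {x : Plane} (i : Fin 2)
    (hf : DifferentiableAt ℝ (fun x => f (toTorus x)) x) :
    torusPartial i f (toTorus x) = fderiv ℝ (fun x => f (toTorus x)) x (frame i) := by
  have hline : HasDerivAt (fun s : ℝ => x + s • frame i) (frame i) 0 := by
    simpa using ((hasDerivAt_id (0 : ℝ)).smul_const (frame i)).const_add x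
  have hf' : DifferentiableAt ℝ (fun x => f (toTorus x)) (x + (0 : ℝ) • frame i) := by simpa using hf
  have h := hf'.hasFDerivAt.comp_hasDerivAt (0 : ℝ) hline
  have heq : (fun s : ℝ => f (toTorus x + toTorus (EuclideanSpace.single i s))) =
      (fun x => f (toTorus x)) ∘ fun s : ℝ => x + s • frame i := by
    ext s
    rw [single_eq_smul_frame, ← toTorus_add]
    rfl
  rw [torusPartial, heq, h.deriv]
  simp

theorem torusPartial_torusPartial_toTorus {f : Torus → ℂ} (hf : TorusContDiff 2 f) (i j : Fin 2)
    (x : Plane) : torusPartial i (torusPartial j f) (toTorus x) =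
      fderiv ℝ (fderiv ℝ (fun x => f (toTorus x))) x (frame i) (frame j) := by
  have h1 : Differentiable ℝ (fun x => f (toTorus x)) := hf.differentiable (by norm_num)
  have h2 : Differentiable ℝ (fderiv ℝ (fun x => f (toTorus x))) :=
    (hf.fderiv_right (m := 1) (by norm_num)).differentiable (by norm_num)
  have heq : (fun x => torusPartial j f (toTorus x)) =
      fun x => fderiv ℝ (fun x => f (toTorus x)) x (frame j) :=
    funext fun x => torusPartial_toTorus j (h1 x)
  have h3 := (h2 x).hasFDerivAt.clm_apply (hasFDerivAt_const (frame j) x)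
  rw [torusPartial_toTorus, heq, h3.fderiv]
  · simp
  · rw [heq]
    exact h3.differentiableAt

theorem unitField_apply {ε : ℝ} (hε : |ε| < 1) (t : ℝ) (i : Fin 2) : unitField ε t i =
    (1 - ε ^ 2) / (circleRadius ε t - ε * Real.cos t) * dir (t : Real.Angle) i := by
  have ha := one_sub_sq_pos hε
  have h := circleRadius_sub_pos hε t
  have e : (dir (t : Real.Angle)) 0 = Real.cos t := by simp [dir_coe]
  simp only [unitField, randersNorm_eq, PiLp.smul_apply, smul_eq_mul, e]
  change (_ * (circleRadius ε t - _))⁻¹ * _ = _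
  field_simp

theorem differentiable_unitField {ε : ℝ} (hε : |ε| < 1) :
    Differentiable ℝ fun t : ℝ => unitField ε t := by
  have heq : (fun t : ℝ => unitField ε t) = fun t : ℝ =>
      ((1 - ε ^ 2) / (circleRadius ε t - ε * Real.cos t)) •
        (Real.cos t • frame 0 + Real.sin t • frame 1) := by
    ext1 t
    apply plane_ext
    · rw [unitField_apply hε, dir_coe]; simp
    · rw [unitField_apply hε, dir_coe]; simp
  rw [heq]
  have hR : Differentiable ℝ (circleRadius ε) := (contDiff_circleRadius hε).differentiable (by simp)
  refine Differentiable.smul (Differentiable.div (by fun_prop) (by fun_prop)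
    fun t => (circleRadius_sub_pos hε t).ne') (by fun_prop)

theorem lieDeriv_base (X : HTorus → HModel) {f : Torus → ℂ} (x : Plane) (θ : Real.Angle)
    (hf : DifferentiableAt ℝ (fun x => f (toTorus x)) x) :
    lieDeriv X (fun h => f h.1) (toTorus x, θ) =
      fderiv ℝ (fun x => f (toTorus x)) x (X (toTorus x, θ)).1 := by
  have h : HasFDerivAt (fun u : HModel => x + u.1) (ContinuousLinearMap.fst ℝ Plane ℝ) 0 :=
    hasFDerivAt_fst.const_add x
  have hf' : DifferentiableAt ℝ (fun x => f (toTorus x)) (x + (0 : HModel).1) := by simpa using hf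
  have h2 := hf'.hasFDerivAt.comp (0 : HModel) h
  have heq : (fun u : HModel => f ((toTorus x, θ) + toH u : HTorus).1) =
      (fun x => f (toTorus x)) ∘ fun u : HModel => x + u.1 := by
    ext u
    simp [toH, toTorus_add]
  rw [lieDeriv, heq, h2.fderiv]
  simp

/-- The field is horizontal and depends only on the angle, so it is constant along itself: the term
with the derivative of `Y` is multiplied by the zero vertical component, and only the Hessian
remains. -/
theorem lieDeriv_lieDeriv_base {Y : Real.Angle → Plane}
    (hY : Differentiable ℝ fun t : ℝ => Y t) {f : Torus → ℂ} (hf : TorusContDiff 2 f) (x : Plane)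
    (t : ℝ) :
    lieDeriv (fun h => (Y h.2, 0)) (lieDeriv (fun h => (Y h.2, 0)) fun h => f h.1)
        (toTorus x, (t : Real.Angle)) =
      fderiv ℝ (fderiv ℝ (fun x => f (toTorus x))) x (Y t) (Y t) := by
  have h1 : Differentiable ℝ (fun x => f (toTorus x)) := hf.differentiable (by norm_num)
  have h2 : Differentiable ℝ (fderiv ℝ (fun x => f (toTorus x))) :=
    (hf.fderiv_right (m := 1) (by norm_num)).differentiable (by norm_num)
  have heq : (fun u : HModel => lieDeriv (fun h => (Y h.2, 0)) (fun h => f h.1)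
      ((toTorus x, (t : Real.Angle)) + toH u : HTorus)) = fun u : HModel =>
      fderiv ℝ (fun x => f (toTorus x)) (x + u.1) (Y ((t + u.2 : ℝ) : Real.Angle)) := by
    ext u
    have : ((toTorus x, (t : Real.Angle)) + toH u : HTorus) =
        (toTorus (x + u.1), ((t + u.2 : ℝ) : Real.Angle)) := by
      simp [toH, toTorus_add]
    rw [this, lieDeriv_base _ _ _ (h1 _)]
  have hx : HasFDerivAt (fun u : HModel => x + u.1) (ContinuousLinearMap.fst ℝ Plane ℝ) 0 :=
    hasFDerivAt_fst.const_add x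
  have ht : HasFDerivAt (fun u : HModel => t + u.2) (ContinuousLinearMap.snd ℝ Plane ℝ) 0 :=
    hasFDerivAt_snd.const_add t
  have hA := (h2 (x + (0 : HModel).1)).hasFDerivAt.comp (0 : HModel) hx
  have hB := (hY (t + (0 : HModel).2)).hasFDerivAt.comp (0 : HModel) ht
  have h := hA.clm_apply hB
  rw [lieDeriv, heq]
  have h' : fderiv ℝ (fun u : HModel =>
      fderiv ℝ (fun x => f (toTorus x)) (x + u.1) (Y ((t + u.2 : ℝ) : Real.Angle))) 0 = _ :=
    h.fderiv
  rw [h']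
  simp

/-- The factor `1 / F²` from the two unit vectors is simplified through `(R - ε cos t)(R + ε cos t)
= 1 - ε²`, which moves the non-reversible part into a numerator linear in `cos t`. -/
theorem angleDensity_mul_unitField {ε : ℝ} (hε : |ε| < 1) (t x y z : ℝ) :
    angleDensity ε t * (x * unitField ε t 0 ^ 2 + y * (unitField ε t 0 * unitField ε t 1) +
        z * unitField ε t 1 ^ 2) = √(1 - ε ^ 2) * (1 - ε ^ 2) *
      ((x * Real.cos t ^ 2 + y * (Real.cos t * Real.sin t) + z * Real.sin t ^ 2) /
        circleRadius ε t ^ 2 * (1 + ε * Real.cos t / circleRadius ε t)) := by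
  have ha := one_sub_sq_pos hε
  have hR := circleRadius_pos hε t
  have hF := circleRadius_sub_pos hε t
  have hR2 := circleRadius_sq hε t
  have h1 := Real.sin_sq_add_cos_sq t
  have e0 : (dir (t : Real.Angle)) 0 = Real.cos t := by simp [dir_coe]
  have e1 : (dir (t : Real.Angle)) 1 = Real.sin t := by simp [dir_coe]
  have hprod : (circleRadius ε t - ε * Real.cos t) * (circleRadius ε t + ε * Real.cos t) =
      1 - ε ^ 2 := by
    linear_combination hR2 + (1 - ε ^ 2) * h1
  rw [unitField_apply hε, unitField_apply hε, angleDensity, e0, e1]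
  field_simp
  rw [← hprod]
  ring

theorem continuous_angleDensity_mul_unitField {ε : ℝ} (hε : |ε| < 1) (i j : Fin 2) :
    Continuous fun t : ℝ => angleDensity ε t * (unitField ε t i * unitField ε t j) := by
  have hX := (differentiable_unitField hε).continuous
  have hi : ∀ i, Continuous fun t : ℝ => unitField ε t i := fun i => (coframe i).continuous.comp hX
  exact (contDiff_angleDensity hε).continuous.mul ((hi i).mul (hi j))

theorem integral_angleDensity_mul_unitField {ε : ℝ} (hε : |ε| < 1) :
    ∫ t in (0 : ℝ)..(2 * π), angleDensity ε t * (unitField ε t 0 * unitField ε t 0) =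
        π * (√(1 - ε ^ 2) * (2 * (1 - ε ^ 2) / (1 + √(1 - ε ^ 2)))) ∧
    ∫ t in (0 : ℝ)..(2 * π), angleDensity ε t * (unitField ε t 0 * unitField ε t 1) = 0 ∧
    ∫ t in (0 : ℝ)..(2 * π), angleDensity ε t * (unitField ε t 1 * unitField ε t 1) =
        π * (2 * (1 - ε ^ 2) / (1 + √(1 - ε ^ 2))) := by
  have hs := Real.sqrt_pos.2 (one_sub_sq_pos hε)
  obtain ⟨hcos, hsin⟩ := integral_sq_div_circleRadius_sq hε
  refine ⟨?_, ?_, ?_⟩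
  · have e := fun t => angleDensity_mul_unitField hε t 1 0 0
    simp only [one_mul, zero_mul, add_zero] at e
    simp only [← pow_two, e, intervalIntegral.integral_const_mul]
    rw [integral_mul_one_add_cos_div hε (g := fun t => Real.cos t ^ 2) (by fun_prop)
      fun t => by simp, hcos]
    ring
  · have e := fun t => angleDensity_mul_unitField hε t 0 1 0
    simp only [one_mul, zero_mul, add_zero, zero_add] at e
    simp only [e, intervalIntegral.integral_const_mul]
    rw [integral_mul_one_add_cos_div hε (g := fun t => Real.cos t * Real.sin t) (by fun_prop)
      fun t => by simp, integral_sin_mul_cos_div_circleRadius_sq, mul_zero]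
  · have e := fun t => angleDensity_mul_unitField hε t 0 0 1
    simp only [one_mul, zero_mul, add_zero, zero_add] at e
    simp only [← pow_two, e, intervalIntegral.integral_const_mul]
    rw [integral_mul_one_add_cos_div hε (g := fun t => Real.sin t ^ 2) (by fun_prop)
      fun t => by simp, hsin]
    field_simp

theorem finslerLaplacian_randersNorm {ε : ℝ} (hε : |ε| < 1) {f : Torus → ℂ}
    (hf : TorusContDiff 2 f) (q : Torus) :
    finslerLaplacian (fun _ => randersNorm ε) f q =
      ((2 * (1 - ε ^ 2) / (1 + √(1 - ε ^ 2)) : ℝ) : ℂ) *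
        (((√(1 - ε ^ 2) : ℝ) : ℂ) * torusPartial 0 (torusPartial 0 f) q
          + torusPartial 1 (torusPartial 1 f) q) := by
  obtain ⟨x, rfl⟩ := toTorus_surjective q
  rw [torusPartial_torusPartial_toTorus hf, torusPartial_torusPartial_toTorus hf]
  set B := fderiv ℝ (fderiv ℝ (fun x => f (toTorus x))) x with hB
  have hexp : ∀ v : Plane, B v v = (v 0 * v 0) • B (frame 0) (frame 0) +
      (v 0 * v 1) • (B (frame 0) (frame 1) + B (frame 1) (frame 0)) +
      (v 1 * v 1) • B (frame 1) (frame 1) := by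
    intro v
    conv_lhs => rw [plane_eq_frame v]
    simp
    ring
  have hint : ∀ i j : Fin 2, ∀ z : ℂ, IntervalIntegrable (fun t : ℝ =>
      (angleDensity ε t * (unitField ε t i * unitField ε t j)) • z) MeasureTheory.volume 0 (2 * π) :=
    fun i j z => ((continuous_angleDensity_mul_unitField hε i j).smul
      continuous_const).intervalIntegrable _ _
  obtain ⟨h00, h01, h11⟩ := integral_angleDensity_mul_unitField hε
  rw [finslerLaplacian, reebField_randersNorm hε]
  simp only [angleForm_randersNorm hε, lieDeriv_lieDeriv_base (differentiable_unitField hε) hf, ← hB,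
    fun t : ℝ => hexp (unitField ε t), smul_add, smul_smul]
  simp only [← smul_add]
  rw [intervalIntegral.integral_add ((hint 0 0 _).add (hint 0 1 _)) (hint 1 1 _),
    intervalIntegral.integral_add (hint 0 0 _) (hint 0 1 _), intervalIntegral.integral_smul_const,
    intervalIntegral.integral_smul_const, intervalIntegral.integral_smul_const, h00, h01, h11]
  have hpi : (π : ℂ) ≠ 0 := by exact_mod_cast Real.pi_ne_zero
  simp only [Complex.real_smul, Complex.ofReal_zero, zero_mul, add_zero]
  push_cast
  field_simp

/-! ### Fourier analysis on the torus and the spectrum -/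

/-- The Haar probability measure of the torus. -/
def haarTorus : MeasureTheory.Measure Torus := MeasureTheory.Measure.pi fun _ => AddCircle.haarAddCircle

instance : MeasureTheory.IsProbabilityMeasure haarTorus :=
  inferInstanceAs (MeasureTheory.IsProbabilityMeasure (MeasureTheory.Measure.pi _))

instance : haarTorus.IsAddRightInvariant :=
  inferInstanceAs ((MeasureTheory.Measure.pi _).IsAddRightInvariant)

theorem mFourierCoeff_eq (f : Torus → ℂ) (n : Fin 2 → ℤ) :
    UnitAddTorus.mFourierCoeff f n = ∫ q, UnitAddTorus.mFourier (-n) q * f q ∂haarTorus := rfl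

theorem isOpenQuotientMap_toTorus : IsOpenQuotientMap toTorus := by
  have h : IsOpenQuotientMap (Pi.map fun (_ : Fin 2) (x : ℝ) => (x : UnitAddCircle)) :=
    IsOpenQuotientMap.piMap fun _ => QuotientAddGroup.isOpenQuotientMap_mk
  exact h.comp (PiLp.homeomorph 2 fun _ : Fin 2 => ℝ).isOpenQuotientMap

theorem TorusContDiff.continuous {f : Torus → ℂ} {k : WithTop ℕ∞} (hf : TorusContDiff k f) :
    Continuous f :=
  isOpenQuotientMap_toTorus.isQuotientMap.continuous_iff.2 (ContDiff.continuous hf)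

theorem TorusContDiff.torusPartial {f : Torus → ℂ} {m k : WithTop ℕ∞} (hf : TorusContDiff k f)
    (hmk : m + 1 ≤ k) (i : Fin 2) : TorusContDiff m (torusPartial i f) := by
  have h1 : Differentiable ℝ (fun x => f (toTorus x)) :=
    ContDiff.differentiable hf (fun h => by simp [h] at hmk)
  have heq : (fun x => FinslerTorus.torusPartial i f (toTorus x)) =
      fun x => fderiv ℝ (fun x => f (toTorus x)) x (frame i) :=
    funext fun x => torusPartial_toTorus i (h1 x)
  rw [TorusContDiff, heq]
  exact (ContDiff.fderiv_right hf hmk).clm_apply contDiff_const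

theorem mFourier_add_apply (n : Fin 2 → ℤ) (x y : Torus) :
    UnitAddTorus.mFourier n (x + y) = UnitAddTorus.mFourier n x * UnitAddTorus.mFourier n y := by
  simp [UnitAddTorus.mFourier, fourier_apply, AddCircle.toCircle_add, ← mul_assoc]
  ring

theorem mFourier_toTorus (n : Fin 2 → ℤ) (x : Plane) : UnitAddTorus.mFourier n (toTorus x) =
    Complex.exp (2 * π * Complex.I * (n 0 * x 0 + n 1 * x 1)) := by
  simp only [UnitAddTorus.mFourier, ContinuousMap.coe_mk, Fin.prod_univ_two, toTorus,
    fourier_coe_apply, ← Complex.exp_add]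
  congr 1
  push_cast
  ring

theorem hasDerivAt_mFourier_line (n : Fin 2 → ℤ) (i : Fin 2) :
    HasDerivAt (fun s : ℝ => UnitAddTorus.mFourier n (toTorus (EuclideanSpace.single i s)))
      (2 * π * Complex.I * n i) 0 := by
  have heq : (fun s : ℝ => UnitAddTorus.mFourier n (toTorus (EuclideanSpace.single i s))) =
      fun s : ℝ => Complex.exp ((s : ℂ) * (2 * π * Complex.I * n i)) := by
    ext s
    rw [mFourier_toTorus]
    congr 1
    fin_cases i <;> simp <;> ring
  rw [heq]
  have h : HasDerivAt (fun s : ℝ => (s : ℂ)) 1 0 := Complex.ofRealCLM.hasDerivAt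
  simpa using (h.mul_const (2 * π * Complex.I * n i)).cexp

theorem torusContDiff_mFourier (n : Fin 2 → ℤ) : TorusContDiff ∞ (UnitAddTorus.mFourier n) := by
  have heq : (fun x : Plane => UnitAddTorus.mFourier n (toTorus x)) = fun x : Plane =>
      Complex.exp (2 * π * Complex.I * (n 0 * x 0 + n 1 * x 1)) := funext (mFourier_toTorus n)
  have hc : ∀ i, ContDiff ℝ ∞ (fun x : Plane => (x i : ℂ)) := fun i =>
    Complex.ofRealCLM.contDiff.comp (coframe i).contDiff
  rw [TorusContDiff, heq]
  exact (contDiff_const.mul ((contDiff_const.mul (hc 0)).add (contDiff_const.mul (hc 1)))).cexp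

theorem torusPartial_mFourier (n : Fin 2 → ℤ) (i : Fin 2) (c : ℂ) :
    torusPartial i (fun q => c * UnitAddTorus.mFourier n q) =
      fun q => (2 * π * Complex.I * n i) * c * UnitAddTorus.mFourier n q := by
  ext q
  simp only [torusPartial, mFourier_add_apply, ← mul_assoc]
  rw [((hasDerivAt_mFourier_line n i).const_mul _).deriv]
  ring

/-- Translating `f` by `τ s` multiplies its `n`-th coefficient by the character value at `τ s`;
differentiating at `s = 0` under the integral sign replaces integration by parts. -/
theorem mFourierCoeff_torusPartial {f : Torus → ℂ} (hf : TorusContDiff 1 f) (n : Fin 2 → ℤ)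
    (i : Fin 2) : UnitAddTorus.mFourierCoeff (torusPartial i f) n =
      2 * π * Complex.I * n i * UnitAddTorus.mFourierCoeff f n := by
  have hcont : Continuous (torusPartial i f) :=
    (hf.torusPartial (m := 0) (by norm_num) i).continuous
  have hfc := hf.continuous
  set τ : ℝ → Torus := fun s => toTorus (EuclideanSpace.single i s) with hτ
  have hτ_add : ∀ s r, τ (s + r) = τ s + τ r := by
    intro s r
    simp only [hτ, ← toTorus_add]
    rw [single_eq_smul_frame i (s + r), single_eq_smul_frame i s, single_eq_smul_frame i r, add_smul]
  have hderiv : ∀ q s, HasDerivAt (fun s => f (q + τ s)) (torusPartial i f (q + τ s)) s := by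
    intro q s
    obtain ⟨x, hx⟩ := toTorus_surjective (q + τ s)
    have hd : Differentiable ℝ (fun x => f (toTorus x)) := ContDiff.differentiable hf (by norm_num)
    have hline : HasDerivAt (fun r : ℝ => x + (r - s) • frame i) (frame i) s := by
      simpa using (((hasDerivAt_id s).sub_const s).smul_const (frame i)).const_add x
    have h := (hd (x + (s - s) • frame i)).hasFDerivAt.comp_hasDerivAt s hline
    have heq : (fun r => f (q + τ r)) = (fun x => f (toTorus x)) ∘ fun r => x + (r - s) • frame i := by
      ext r
      simp only [Function.comp, toTorus_add, hx, ← single_eq_smul_frame]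
      rw [add_assoc, ← hτ_add]
      simp
    rw [heq, ← hx, torusPartial_toTorus i (hd x)]
    simpa using h
  -- The bound on the continuous partial derivative, from compactness, is the dominating constant.
  obtain ⟨C, hC⟩ : ∃ C, ∀ q, ‖torusPartial i f q‖ ≤ C := by
    obtain ⟨C, hC⟩ := isCompact_univ.exists_bound_of_continuousOn hcont.continuousOn
    exact ⟨C, fun q => hC q trivial⟩
  have hint : ∀ g : Torus → ℂ, Continuous g → MeasureTheory.Integrable g haarTorus := fun g hg =>
    hg.integrable_of_hasCompactSupport (HasCompactSupport.of_compactSpace g)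
  have hF := hasDerivAt_integral_of_dominated_loc_of_deriv_le (μ := haarTorus) (𝕜 := ℝ)
    (F := fun s q => UnitAddTorus.mFourier (-n) q * f (q + τ s))
    (F' := fun s q => UnitAddTorus.mFourier (-n) q * torusPartial i f (q + τ s))
    (x₀ := 0) (s := Set.univ) (bound := fun _ => C) Filter.univ_mem
    (Filter.Eventually.of_forall fun s => (hint _ (by fun_prop)).aestronglyMeasurable)
    (hint _ (by fun_prop)) (hint _ (by fun_prop)).aestronglyMeasurable
    (Filter.Eventually.of_forall fun q s _ => by
      have h1 := (UnitAddTorus.mFourier (-n)).norm_coe_le_norm q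
      rw [UnitAddTorus.mFourier_norm] at h1
      rw [norm_mul]
      calc _ ≤ 1 * C := mul_le_mul h1 (hC _) (norm_nonneg _) zero_le_one
        _ = C := one_mul C)
    (MeasureTheory.integrable_const C)
    (Filter.Eventually.of_forall fun q s _ => (hderiv q s).const_mul _)
  have hleft : (fun s => ∫ q, UnitAddTorus.mFourier (-n) q * f (q + τ s) ∂haarTorus) =
      fun s => UnitAddTorus.mFourier n (τ s) * UnitAddTorus.mFourierCoeff f n := by
    ext s
    rw [mFourierCoeff_eq, ← MeasureTheory.integral_add_right_eq_self
      (fun q => UnitAddTorus.mFourier (-n) q * f q) (τ s), ← MeasureTheory.integral_const_mul]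
    congr 1
    ext q
    have : UnitAddTorus.mFourier n (τ s) * UnitAddTorus.mFourier (-n) (τ s) = 1 := by
      rw [← UnitAddTorus.mFourier_add, add_neg_cancel, UnitAddTorus.mFourier_zero]
      rfl
    rw [mFourier_add_apply]
    linear_combination (- UnitAddTorus.mFourier (-n) q * f (q + τ s)) * this
  have h2 := hF.2
  rw [hleft] at h2
  have h3 := h2.unique ((hasDerivAt_mFourier_line n i).mul_const (UnitAddTorus.mFourierCoeff f n))
  have hτ0 : τ 0 = 0 := by
    have := hτ_add 0 0
    simpa using this
  simp only [hτ0, add_zero] at h3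
  rw [mFourierCoeff_eq, h3]

/-- If all coefficients vanished they would be summable, so the Fourier series would converge
pointwise to `f` with sum zero. -/
theorem exists_mFourierCoeff_ne_zero {f : Torus → ℂ} (hf : Continuous f) (h0 : f ≠ 0) :
    ∃ n, UnitAddTorus.mFourierCoeff f n ≠ 0 := by
  by_contra! h
  apply h0
  ext q
  have hz : UnitAddTorus.mFourierCoeff (⟨f, hf⟩ : C(Torus, ℂ)) = 0 := funext h
  have hs : Summable (UnitAddTorus.mFourierCoeff (⟨f, hf⟩ : C(Torus, ℂ))) := by
    rw [hz]; exact summable_zero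
  have h1 := UnitAddTorus.hasSum_mFourier_series_apply_of_summable hs q
  rw [hz] at h1
  simp only [Pi.zero_apply, zero_smul] at h1
  exact h1.unique hasSum_zero

theorem TorusContDiff.two {f : Torus → ℂ} (hf : TorusContDiff ∞ f) : TorusContDiff 2 f :=
  ContDiff.of_le hf (WithTop.coe_le_coe.2 le_top : ((2 : ℕ∞) : WithTop ℕ∞) ≤ _)

theorem laplaceSpectrum_randersNorm {ε : ℝ} (hε : |ε| < 1) :
    laplaceSpectrum (fun _ => randersNorm ε) =
      {l : ℂ | ∃ p q : ℤ, l =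
        ((4 * π ^ 2 * (2 * (1 - ε ^ 2) / (1 + √(1 - ε ^ 2))) *
          (√(1 - ε ^ 2) * (p : ℝ) ^ 2 + (q : ℝ) ^ 2) : ℝ) : ℂ)} := by
  have hΔ := fun (f : Torus → ℂ) (hf : TorusContDiff 2 f) => finslerLaplacian_randersNorm hε hf
  -- From here on only the form `κ (s ∂ₓ² + ∂ᵧ²)` with real constants matters.
  generalize 2 * (1 - ε ^ 2) / (1 + √(1 - ε ^ 2)) = κ at hΔ ⊢
  generalize √(1 - ε ^ 2) = s at hΔ ⊢
  have hI : Complex.I ^ 2 = -1 := Complex.I_sq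
  ext l
  constructor
  · rintro ⟨u, hu, hu0, heq⟩
    obtain ⟨n, hn⟩ := exists_mFourierCoeff_ne_zero hu.continuous hu0
    have hu2 : TorusContDiff 2 u := hu.two
    have hu1 : TorusContDiff 1 u := ContDiff.of_le hu (by exact_mod_cast le_top)
    have hp : ∀ i, TorusContDiff 1 (torusPartial i u) := fun i => hu2.torusPartial (by norm_num) i
    have hpp : ∀ i, Continuous (torusPartial i (torusPartial i u)) := fun i =>
      ((hp i).torusPartial (m := 0) (by norm_num) i).continuous
    have hc : ∀ i, UnitAddTorus.mFourierCoeff (torusPartial i (torusPartial i u)) n =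
        (2 * π * Complex.I * n i) ^ 2 * UnitAddTorus.mFourierCoeff u n := by
      intro i
      rw [mFourierCoeff_torusPartial (hp i), mFourierCoeff_torusPartial hu1]
      ring
    have hint : ∀ g : Torus → ℂ, Continuous g →
        MeasureTheory.Integrable (fun q => UnitAddTorus.mFourier (-n) q * g q) haarTorus :=
      fun g hg => Continuous.integrable_of_hasCompactSupport (by fun_prop)
        (HasCompactSupport.of_compactSpace _)
    -- Integrating the eigenvalue equation against a character with nonzero coefficient turns it
    -- into a scalar equation for `l`.
    have hzero : ∀ q, (κ * s : ℂ) * (UnitAddTorus.mFourier (-n) q *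
          torusPartial 0 (torusPartial 0 u) q) +
        (κ : ℂ) * (UnitAddTorus.mFourier (-n) q * torusPartial 1 (torusPartial 1 u) q) +
        l * (UnitAddTorus.mFourier (-n) q * u q) = 0 := by
      intro q
      have := heq q
      rw [hΔ u hu2] at this
      linear_combination UnitAddTorus.mFourier (-n) q * this
    have hI0 := MeasureTheory.integral_congr_ae (μ := haarTorus)
      (Filter.Eventually.of_forall hzero)
    rw [MeasureTheory.integral_add (f := fun q => (κ * s : ℂ) * (UnitAddTorus.mFourier (-n) q *
        torusPartial 0 (torusPartial 0 u) q) + (κ : ℂ) * (UnitAddTorus.mFourier (-n) q *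
        torusPartial 1 (torusPartial 1 u) q)) (((hint _ (hpp 0)).const_mul _).add ((hint _ (hpp 1)).const_mul _))
      ((hint _ hu.continuous).const_mul _), MeasureTheory.integral_add
      ((hint _ (hpp 0)).const_mul _) ((hint _ (hpp 1)).const_mul _),
      MeasureTheory.integral_const_mul, MeasureTheory.integral_const_mul,
      MeasureTheory.integral_const_mul, ← mFourierCoeff_eq, ← mFourierCoeff_eq, ← mFourierCoeff_eq,
      hc, hc, MeasureTheory.integral_zero] at hI0
    refine ⟨n 0, n 1, mul_right_cancel₀ hn ?_⟩
    push_cast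
    linear_combination hI0 - 4 * π ^ 2 * κ * (s * n 0 ^ 2 + n 1 ^ 2) *
      UnitAddTorus.mFourierCoeff u n * hI
  · rintro ⟨p, q, rfl⟩
    have hu := torusContDiff_mFourier ![p, q]
    refine ⟨UnitAddTorus.mFourier ![p, q], hu, fun h => ?_, fun x => ?_⟩
    · have := UnitAddTorus.mFourier_norm (n := ![p, q])
      rw [DFunLike.coe_injective (h.trans ContinuousMap.coe_zero.symm), norm_zero] at this
      exact zero_ne_one this
    · rw [hΔ _ hu.two]
      have h1 : ∀ i, torusPartial i (torusPartial i (UnitAddTorus.mFourier ![p, q])) =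
          fun x => (2 * π * Complex.I * (![p, q] i : ℤ)) ^ 2 * UnitAddTorus.mFourier ![p, q] x := by
        intro i
        have := torusPartial_mFourier ![p, q] i 1
        simp only [one_mul, mul_one] at this
        rw [this, torusPartial_mFourier]
        ext x
        ring
      rw [h1, h1]
      simp only [Matrix.cons_val_zero, Matrix.cons_val_one]
      push_cast
      linear_combination 4 * π ^ 2 * κ * (s * p ^ 2 + q ^ 2) *
        UnitAddTorus.mFourier ![p, q] x * hI

end FinslerTorus

end

theorem mainTheorem5 (ε : ℝ) (hε : |ε| < 1) :
    IsFinslerMetric (torusKatokZiller ε) ∧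
    (∀ (q : Torus) (v : Plane), torusKatokZiller ε q v =
      1 / (1 - ε ^ 2) * (√(v 0 ^ 2 + (1 - ε ^ 2) * v 1 ^ 2) - ε * v 0)) ∧
    (∀ f : Torus → ℂ, TorusContDiff 2 f → ∀ q : Torus,
      finslerLaplacian (torusKatokZiller ε) f q =
        ((2 * (1 - ε ^ 2) / (1 + √(1 - ε ^ 2)) : ℝ) : ℂ) *
          (((√(1 - ε ^ 2) : ℝ) : ℂ) * torusPartial 0 (torusPartial 0 f) q
            + torusPartial 1 (torusPartial 1 f) q)) ∧
    laplaceSpectrum (torusKatokZiller ε) =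
      {l : ℂ | ∃ p q : ℤ, l =
        ((4 * π ^ 2 * (2 * (1 - ε ^ 2) / (1 + √(1 - ε ^ 2))) *
          (√(1 - ε ^ 2) * (p : ℝ) ^ 2 + (q : ℝ) ^ 2) : ℝ) : ℂ)} := by
  rw [torusKatokZiller_eq hε]
  exact ⟨isFinslerMetric_randersNorm hε, fun _ _ => rfl,
    fun _ hf q => finslerLaplacian_randersNorm hε hf q, laplaceSpectrum_randersNorm hε⟩
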